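/- Let $m\ge 1$, let $W$ be a complex vector space of dimension $m+1$, and let $S\subset\mathbb P W$ be a CR-hypersurface, i.e. an embedded smooth ($C^\infty$) real hypersurface. Let $\widehat S=\{w\in W\setminus\{0\} : [w]\in S\}$ be the cone over $S$. Let $\mathcal F$ be the manifold of complex bases $f=(f_0,\dots,f_m)$ of $W$, and let $\Omega=(\Omega^b_a)$ be the Maurer–Cartan form on $\mathcal F$, defined by $\mathrm d f_a=\sum_b\Omega^b_a f_b$. Let $\mathcal F_S\subset\mathcal F$ be the set of adapted frames: those with $[f_0]\in S$ and $$\mathrm{span}_{\mathbb R}\{f_0,\mathrm i f_0,\dots,f_{m-1},\mathrm i f_{m-1},f_m\}=T_{f_0}\widehat S\subset W .$$ Indices $\alpha,\beta$ range over $0<\alpha,\beta<m$ and repeated ones are summed. There are uniquely determined functions $P_{\alpha\beta},P_{\alpha\bar\beta},P_{\alpha m},P_{mm}:\mathcal F_S\to\mathbb C$ (the second-order coefficients) such that, on $\mathcal F_S$, $$\Omega^m_\alpha=P_{\alpha\beta}\Omega^\beta_0+P_{\alpha\bar\beta}\bar\Omega^\beta_0+P_{\alpha m}\Omega^m_0,$$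 $$(\Omega^0_0+\bar\Omega^m_m)-(\bar\Omega^0_0+\Omega^m_m)=-P_{\alpha m}\Omega^\alpha_0+\bar P_{\alpha m}\bar\Omega^\alpha_0+P_{mm}\Omega^m_0 .$$ They are smooth, and $P_{\beta\alpha}=P_{\alpha\beta}$, $\overline{P_{\alpha\bar\beta}}=-P_{\beta\bar\alpha}$, $\overline{P_{mm}}=-P_{mm}$. The subset $\mathcal P_S\subset\mathcal F_S$ on which all $P_{\alpha m}$ and $P_{mm}$ vanish is a smooth sub-bundle of $\mathcal F_S\to S$, $f\mapsto[f_0]$: $\mathcal F_S$ and $\mathcal P_S$ are embedded submanifolds of $\mathcal F$, $\mathcal P_S$ maps onto $S$, and near every point of $S$ there is a smooth local trivialization of $\mathcal F_S$ that restricts to one of $\mathcal P_S$. The restriction of $\Omega$ to $\mathcal P_S$ satisfies $$\bar\Omega^m_0=\Omega^m_0,\qquad \Omega^m_\alpha=P_{\alpha\beta}\Omega^\beta_0+P_{\alpha\bar\beta}\bar\Omega^\beta_0,\qquad \Omega^0_0+\bar\Omega^m_m=\bar\Omega^0_0+\Omega^m_m,$$ with $P_{\beta\alpha}=P_{\alpha\beta}$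 and $\overline{P_{\alpha\bar\beta}}=-P_{\beta\bar\alpha}$. -/

import Mathlib

open scoped ContDiff Topology ComplexConjugate LinearAlgebra.Projectivization

noncomputable section

namespace CRHyp

/-! ### Smooth subsets of real vector spaces -/

section Smooth

variable {E : Type*} [NormedAddCommGroup E] [NormedSpace ℝ E]

/-- The vectors tangent to a subset `M` of a real vector space at the point `p`: the velocities
at time `0` of the smooth curves through `p` that stay in `M`.  For an embedded submanifold this
is the tangent space at `p`, as a linear subspace of the ambient space. -/
def tangentVectors (M : Set E) (p : E) : Set E :=
  {v | ∃ γ : ℝ → E, ContDiff ℝ ∞ γ ∧ (∀ᶠ t in 𝓝 0, γ t ∈ M) ∧ γ 0 = p ∧ deriv γ 0 = v}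

/-- `M` is an embedded smooth submanifold: near each of its points it is a
regular level set of a smooth map, of fixed codimension `d`. -/
def IsEmbeddedSubmanifold (M : Set E) : Prop :=
  ∃ d : ℕ, ∀ p ∈ M, ∃ (U : Set E) (ρ : E → (Fin d → ℝ)),
    IsOpen U ∧ p ∈ U ∧ ContDiffOn ℝ ∞ ρ U ∧ Function.Surjective (fderiv ℝ ρ p) ∧
      ∀ x ∈ U, x ∈ M ↔ ρ x = 0

end Smooth

section Projective

variable {W : Type*} [NormedAddCommGroup W] [NormedSpace ℂ W]

/-! ### Hypersurfaces of projective space -/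

/-- The cone `{w ≠ 0 | [w] ∈ S}` over a subset `S` of projective space. -/
def cone (S : Set (ℙ ℂ W)) : Set W :=
  {w | ∃ h : w ≠ 0, Projectivization.mk ℂ w h ∈ S}

/-- A subset of projective space is open for the quotient topology: its cone is open. -/
def IsOpenProj (U : Set (ℙ ℂ W)) : Prop :=
  IsOpen (cone U)

open Classical in
/-- The pull-back `w ↦ r [w]` to `W ∖ {0}` of a function on projective space
(with value `0` at `w = 0`). -/
def pullback (r : ℙ ℂ W → ℝ) (w : W) : ℝ :=
  if h : w ≠ 0 then r (Projectivization.mk ℂ w h) else 0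

/-- `S` is an embedded smooth real hypersurface of projective space: near each of its points it
is the zero set of a smooth real function with nonvanishing differential.  Projective space
carries the smooth structure of the quotient of `W ∖ {0}` by `ℂˣ`.
Every such hypersurface is a CR-hypersurface, with the CR structure
induced by the ambient complex structure. -/
def IsCRHypersurface (S : Set (ℙ ℂ W)) : Prop :=
  ∀ z ∈ S, ∃ (U : Set (ℙ ℂ W)) (r : ℙ ℂ W → ℝ),
    IsOpenProj U ∧ z ∈ U ∧ ContDiffOn ℝ ∞ (pullback r) (cone U) ∧
      (∀ w ∈ cone (S ∩ U), fderiv ℝ (pullback r) w ≠ 0) ∧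
      ∀ x ∈ U, x ∈ S ↔ r x = 0

/-! ### Frames and the Maurer-Cartan form -/

/-- The frames (complex bases) `(f_0, …, f_m)` of `W`. -/
def frames (W : Type*) [NormedAddCommGroup W] [NormedSpace ℂ W] (m : ℕ) :
    Set (Fin (m + 1) → W) :=
  {f | LinearIndependent ℂ f ∧ ⊤ ≤ Submodule.span ℂ (Set.range f)}

open Classical in
/-- The component `Ω^b_a` of the Maurer-Cartan form on frames, evaluated at
the frame `f` on the tangent vector `v = df`.  It is
defined by `d f_a = ∑ b, Ω^b_a f_b`. -/
def maurerCartan {m : ℕ} (f v : Fin (m + 1) → W) (b a : Fin (m + 1)) : ℂ :=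
  if h : f ∈ frames W m then (Module.Basis.mk h.1 h.2).repr (v a) b else 0

theorem maurerCartan_spec {m : ℕ} {f : Fin (m + 1) → W} (hf : f ∈ frames W m)
    (v : Fin (m + 1) → W) (a : Fin (m + 1)) :
    v a = ∑ b, maurerCartan f v b a • f b := by
  have h := (Module.Basis.mk hf.1 hf.2).sum_repr (v a)
  simp only [Module.Basis.mk_apply] at h
  simp only [maurerCartan, dif_pos hf]
  exact h.symm

/-- The indices `0 < α < m`. -/
abbrev Mid (m : ℕ) : Type :=
  {a : Fin (m + 1) // 0 < a ∧ a < Fin.last m}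

/-- The adapted frames over `S`.  With `e_{2a} = f_a`, `e_{2a+1} = i f_a`
and `n = 2m`, these are the frames with `[e_0] ∈ S` for which the real span of `e_0, …, e_n`
(all vectors of the real frame except `e_{n+1} = i f_m`) is
the tangent space at `e_0` of the cone over `S`. -/
def adaptedFrames (S : Set (ℙ ℂ W)) (m : ℕ) : Set (Fin (m + 1) → W) :=
  {f | f ∈ frames W m ∧ f 0 ∈ cone S ∧
    (Submodule.span ℝ
        (Set.range f ∪ (fun a => Complex.I • f a) '' {a | a ≠ Fin.last m}) : Set W) =
      tangentVectors (cone S) (f 0)}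

/-! ### Second-order coefficients -/

/-- Values of the second-order coefficients at a frame: `hol α β` is `P_{αβ}`, `herm α β` is
`P_{α β̄}`, `mix α` is `P_{αm}` and `nor` is `P_{mm}`. -/
@[ext]
structure SecondOrder (m : ℕ) where
  hol : Mid m → Mid m → ℂ
  herm : Mid m → Mid m → ℂ
  mix : Mid m → ℂ
  nor : ℂ

/-- `P` gives the second-order coefficients of `S` at the adapted frame `f`: on the tangent space
at `f` of the manifold of adapted frames,
`Ω^m_α = P_{αβ} Ω^β_0 + P_{α β̄} conj Ω^β_0 + P_{αm} Ω^m_0` and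
`(Ω^0_0 + conj Ω^m_m) - (conj Ω^0_0 + Ω^m_m)
  = - P_{αm} Ω^α_0 + conj P_{αm} conj Ω^α_0 + P_{mm} Ω^m_0`. -/
structure IsSecondOrder {m : ℕ} (S : Set (ℙ ℂ W)) (f : Fin (m + 1) → W)
    (P : SecondOrder m) : Prop where
  mid : ∀ v ∈ tangentVectors (adaptedFrames S m) f, ∀ α : Mid m,
    maurerCartan f v (Fin.last m) α =
      ∑ β : Mid m, P.hol α β * maurerCartan f v β 0
        + ∑ β : Mid m, P.herm α β * conj (maurerCartan f v β 0)
        + P.mix α * maurerCartan f v (Fin.last m) 0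
  last : ∀ v ∈ tangentVectors (adaptedFrames S m) f,
    (maurerCartan f v 0 0 + conj (maurerCartan f v (Fin.last m) (Fin.last m)))
        - (conj (maurerCartan f v 0 0) + maurerCartan f v (Fin.last m) (Fin.last m)) =
      -∑ α : Mid m, P.mix α * maurerCartan f v α 0
        + ∑ α : Mid m, conj (P.mix α) * conj (maurerCartan f v α 0)
        + P.nor * maurerCartan f v (Fin.last m) 0

/-! ### Bundles of frames over a hypersurface -/

/-- The part of a set `F` of frames that lies over `U`, under `f ↦ [f_0]`. -/
def restrictTo {m : ℕ} (F : Set (Fin (m + 1) → W)) (U : Set (ℙ ℂ W)) : Set (Fin (m + 1) → W) :=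
  {f | f ∈ F ∧ f 0 ∈ cone U}

/-- A smooth local trivialization over `S ∩ U` of the projection `F → S`, `f ↦ [f_0]`, which
restricts to one of `P → S`.  The typical fibres are the fibres `F_z` and `P_z`
over a point `z` of `S ∩ U`.  The trivialization is `f ↦ ([f_0], Φ f)`, its inverse is
`([w], q) ↦ Ψ w q`. -/
structure IsTrivialization {m : ℕ} (S : Set (ℙ ℂ W)) (F P : Set (Fin (m + 1) → W))
    (z : ℙ ℂ W) (U : Set (ℙ ℂ W)) (Φ : (Fin (m + 1) → W) → (Fin (m + 1) → W))
    (Ψ : W → (Fin (m + 1) → W) → (Fin (m + 1) → W)) : Prop where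
  mapsTo : ∀ f ∈ restrictTo F U, Φ f ∈ restrictTo F {z}
  mapsTo_inv : ∀ x ∈ S ∩ U, ∀ w ∈ cone {x}, ∀ q ∈ restrictTo F {z}, Ψ w q ∈ restrictTo F {x}
  right_inv : ∀ w ∈ cone (S ∩ U), ∀ q ∈ restrictTo F {z}, Φ (Ψ w q) = q
  left_inv : ∀ x ∈ S ∩ U, ∀ w ∈ cone {x}, ∀ f ∈ restrictTo F {x}, Ψ w (Φ f) = f
  smooth : ContDiffOn ℝ ∞ Φ (restrictTo F U)
  smooth_inv : ContDiffOn ℝ ∞ (fun p : W × (Fin (m + 1) → W) => Ψ p.1 p.2)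
    (cone (S ∩ U) ×ˢ restrictTo F {z})
  mem_iff : ∀ f ∈ restrictTo F U, f ∈ P ↔ Φ f ∈ P

/-- `P` is a smooth sub-bundle of the bundle `F → S` of frames over `S`: both are embedded
submanifolds of the space of frames, both project onto `S`, and near each point of `S` there is
a smooth local trivialization of `F` which restricts to one of `P`. -/
structure IsSubbundle {m : ℕ} (S : Set (ℙ ℂ W)) (F P : Set (Fin (m + 1) → W)) : Prop where
  subset : P ⊆ F
  base : ∀ f ∈ F, f 0 ∈ cone S
  submanifold_total : IsEmbeddedSubmanifold F
  submanifold : IsEmbeddedSubmanifold P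
  surj : ∀ z ∈ S, (restrictTo P {z}).Nonempty
  locally_trivial : ∀ z ∈ S, ∃ (U : Set (ℙ ℂ W)) (Φ : (Fin (m + 1) → W) → (Fin (m + 1) → W))
    (Ψ : W → (Fin (m + 1) → W) → (Fin (m + 1) → W)),
      IsOpenProj U ∧ z ∈ U ∧ IsTrivialization S F P z U Φ Ψ

end Projective

end CRHyp

end

/-! Near a point of the cone, `S` is cut out by a real function `ρ` that is constant on complex
lines. Let `cform ρ w` be the complex-linear form with real part `dρ` at `w`. It vanishes on `w` and
is homogeneous of degree `-1` in `w`. A frame is adapted exactly when `ρ (f 0) = 0`, `cform ρ (f 0)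
(f α) = 0` and `dρ (f m) = 0`, so that `l = cform ρ (f 0) (f m)` is imaginary and nonzero
(`mem_adaptedFrames_iff`). These equations are regular, so tangent vectors of the frame manifold are
the solutions of the linearized equations (`mem_tangentVectors_adaptedFrames_iff`).

Linearizing `cform ρ (f 0) (f α) = 0` and expanding `df_0` in the frame expresses `Ω^m_α` through
the second derivatives of `ρ`; linearizing `Re l = 0` gives the equation for `Ω^0_0` and `Ω^m_m`
(`isSecondOrder_coeffs`). The symmetries of the coefficients are those of the Hessian, split into a
symmetric complex bilinear part and a Hermitian Levi form. Uniqueness holds because tangent vectors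
realize all complex values of `Ω^β_0` and all real values of `Ω^m_0`.

Replacing `f a` by `f a + d a • f 0` with `d 0 = 0` keeps a frame adapted, adds `d α` to `P_{αm}`
and `-4i Im (d m)` to the imaginary number `P_{mm}` (`secondOrder_shift`). Hence the normalized
locus meets every fibre, and its equations are independent of the adaptedness equations
(`surjective_fderiv_normalMap`). For the local trivialization, complex-linear maps carry the cone's
tangent spaces along nearby lines to a fixed one; a shift then restores the coefficients `mix` and
`nor`, so the normalized locus is respected (`exists_isTrivialization`). The normalized structure
equations follow because vectors tangent to the smaller locus are tangent to the larger one. -/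

noncomputable section

namespace CRHyp

/-! ### Tangent vectors of regular level sets. -/

section LevelSets

variable {E X : Type*} [NormedAddCommGroup E] [NormedSpace ℝ E]
  [NormedAddCommGroup X] [NormedSpace ℝ X]

/-- A curve which is smooth near `0` agrees near `0` with a globally smooth curve. -/
theorem exists_contDiff_eventuallyEq {c : ℝ → E} (hc : ∀ᶠ t in 𝓝 0, ContDiffAt ℝ ∞ c t) :
    ∃ γ : ℝ → E, ContDiff ℝ ∞ γ ∧ γ =ᶠ[𝓝 0] c := by
  obtain ⟨ε, hε, h⟩ := Metric.eventually_nhds_iff.1 hc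
  let b : ContDiffBump (0 : ℝ) := ⟨ε / 4, ε / 2, by positivity, by linarith⟩
  -- The cutoff acts on the parameter: `b t * t` stays in the interval where `c` is smooth, and the
  -- curve is constantly `c 0` for large `|t|`.
  refine ⟨fun t => c (b t * t), ?_, ?_⟩
  · rw [contDiff_iff_contDiffAt]
    intro t
    refine ContDiffAt.comp (g := c) t (h ?_) (b.contDiff.contDiffAt.mul contDiffAt_id)
    by_cases ht : dist t 0 < ε / 2
    · have h1 : |b t| ≤ 1 := by rw [abs_of_nonneg b.nonneg]; exact b.le_one
      simp only [dist_zero_right, Real.norm_eq_abs, abs_mul] at ht ⊢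
      nlinarith [abs_nonneg t, abs_nonneg (b t)]
    · rw [b.zero_of_le_dist (not_lt.1 ht)]
      simpa using hε
  · filter_upwards [b.eventuallyEq_one] with t ht
    simp [ht]

/-- The tangent vectors of a regular level set contain the kernel of the differential. -/
theorem mem_tangentVectors_of_fderiv_eq_zero [FiniteDimensional ℝ E] [FiniteDimensional ℝ X]
    {M U : Set E} {G : E → X} {p v : E} (hU : IsOpen U) (hp : p ∈ U) (hG : ContDiffOn ℝ ∞ G U)
    (hM : ∀ x ∈ U, x ∈ M ↔ G x = 0) (hpM : p ∈ M)
    (hsurj : Function.Surjective (fderiv ℝ G p)) (hv : fderiv ℝ G p v = 0) :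
    v ∈ tangentVectors M p := by
  have : CompleteSpace E := FiniteDimensional.complete ℝ E
  have : CompleteSpace X := FiniteDimensional.complete ℝ X
  obtain ⟨s₀, hs₀⟩ := (fderiv ℝ G p : E →ₗ[ℝ] X).exists_rightInverse_of_surjective
    (LinearMap.range_eq_top.2 hsurj)
  let s : X →L[ℝ] E := LinearMap.toContinuousLinearMap s₀
  have hs : ∀ x, fderiv ℝ G p (s x) = x := fun x => LinearMap.congr_fun hs₀ x
  -- Slice through `p` spanned by `v` and by a complement of the kernel. Since `dG v = 0` and `dG ∘
  -- s = id`, the map `Θ` below has the identity as derivative at `0`.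
  let A : ℝ × X → E := fun y => p + (y.1 • v + s y.2)
  have hA : ContDiff ℝ ∞ A := by fun_prop
  have hA0 : A 0 = p := by simp [A]
  let V : Set (ℝ × X) := A ⁻¹' U
  have hV : IsOpen V := hU.preimage hA.continuous
  have h0V : (0 : ℝ × X) ∈ V := by simpa [V, hA0] using hp
  let Θ : ℝ × X → ℝ × X := fun y => (y.1, G (A y))
  have hΘ : ContDiffOn ℝ ∞ Θ V :=
    contDiff_fst.contDiffOn.prodMk (hG.comp hA.contDiffOn fun _ h => h)
  have hGd : HasFDerivAt G (fderiv ℝ G p) (A 0) := by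
    rw [hA0]
    exact ((hG.contDiffAt (hU.mem_nhds hp)).differentiableAt (by simp)).hasFDerivAt
  have hAd : HasFDerivAt A ((ContinuousLinearMap.fst ℝ ℝ X).smulRight v +
      s.comp (ContinuousLinearMap.snd ℝ ℝ X)) 0 :=
    (((ContinuousLinearMap.fst ℝ ℝ X).smulRight v +
      s.comp (ContinuousLinearMap.snd ℝ ℝ X)).hasFDerivAt).const_add p
  have hΘd : HasFDerivAt Θ (ContinuousLinearEquiv.refl ℝ (ℝ × X) : ℝ × X →L[ℝ] ℝ × X) 0 := by
    refine (hasFDerivAt_fst.prodMk (hGd.comp 0 hAd)).congr_fderiv ?_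
    refine ContinuousLinearMap.ext fun y => ?_
    simp [hv, hs]
  have hΘ0 : ContDiffAt ℝ ∞ Θ 0 := hΘ.contDiffAt (hV.mem_nhds h0V)
  let e := hΘ0.toOpenPartialHomeomorph Θ hΘd (by simp)
  have he : (e : ℝ × X → ℝ × X) = Θ := rfl
  have hes : (0 : ℝ × X) ∈ e.source := hΘ0.mem_toOpenPartialHomeomorph_source hΘd (by simp)
  have hGp : G p = 0 := (hM p hp).1 hpM
  have hΘ00 : Θ 0 = 0 := by simp [Θ, hA0, hGp]
  have het : (0 : ℝ × X) ∈ e.target := by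
    have := e.map_source hes
    rwa [he, hΘ00] at this
  have he0 : e.symm 0 = 0 := by
    have := e.left_inv hes
    rwa [he, hΘ00] at this
  -- The curve must be smooth on a whole interval, so the derivative of `Θ` has to be invertible
  -- near `0` and not only at `0`.
  have hgood : ∀ᶠ y in 𝓝 (0 : ℝ × X), y ∈ V ∧
      fderiv ℝ Θ y ∈ Set.range ((↑) : ((ℝ × X) ≃L[ℝ] (ℝ × X)) → _) := by
    have hVn : ∀ᶠ y in 𝓝 (0 : ℝ × X), y ∈ V := hV.mem_nhds h0V
    refine hVn.and ?_
    have hcont : ContinuousAt (fderiv ℝ Θ) 0 :=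
      (hΘ.continuousOn_fderiv_of_isOpen hV (by simp)).continuousAt (hV.mem_nhds h0V)
    refine hcont.eventually (ContinuousLinearEquiv.isOpen.mem_nhds ?_)
    exact ⟨_, hΘd.fderiv.symm⟩
  have hsymm : ContinuousAt e.symm 0 := e.symm.continuousAt het
  have hsm : ∀ᶠ z in 𝓝 (0 : ℝ × X), z ∈ e.target ∧ e.symm z ∈ V ∧ ContDiffAt ℝ ∞ e.symm z := by
    have h1 : ∀ᶠ z in 𝓝 (0 : ℝ × X), z ∈ e.target := e.open_target.mem_nhds het
    have h2 := hsymm.eventually (by rw [he0]; exact hgood)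
    filter_upwards [h1, h2] with z hz1 hz2
    obtain ⟨hzV, f', hf'⟩ := hz2
    have hd : ContDiffAt ℝ ∞ Θ (e.symm z) := hΘ.contDiffAt (hV.mem_nhds hzV)
    refine ⟨hz1, hzV, e.contDiffAt_symm (f₀' := f') hz1 ?_ hd⟩
    rw [hf']
    exact (hd.differentiableAt (by simp)).hasFDerivAt
  have hline : Filter.Tendsto (fun t : ℝ => ((t, 0) : ℝ × X)) (𝓝 0) (𝓝 0) := by
    have : Continuous (fun t : ℝ => ((t, 0) : ℝ × X)) := by fun_prop
    exact this.tendsto' 0 0 rfl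
  have hev := hline.eventually hsm
  -- This is `A (e.symm (t, 0))`, on which `G` vanishes. The inverse also has identity derivative at
  -- `0`, so the correction by `s` is of second order and the velocity is `v`.
  let c : ℝ → E := fun t => p + (t • v + s (e.symm (t, 0)).2)
  have hcs : ∀ᶠ t in 𝓝 0, ContDiffAt ℝ ∞ c t := by
    filter_upwards [hev] with t ht
    have h1 : ContDiffAt ℝ ∞ (fun t : ℝ => e.symm (t, 0)) t :=
      ContDiffAt.comp (g := e.symm) t ht.2.2 (by fun_prop)
    fun_prop
  have hcM : ∀ᶠ t in 𝓝 0, c t ∈ M := by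
    filter_upwards [hev] with t ht
    have h1 : Θ (e.symm (t, 0)) = (t, 0) := by rw [← he]; exact e.right_inv ht.1
    have h2 : (e.symm (t, 0)).1 = t := congrArg Prod.fst h1
    have h3 : A (e.symm (t, 0)) = c t := by simp only [A, c, h2]
    have h4 : G (A (e.symm (t, 0))) = 0 := congrArg Prod.snd h1
    rw [h3] at h4
    exact (hM _ (h3 ▸ ht.2.1)).2 h4
  have hc0 : c 0 = p := by
    have : e.symm ((0 : ℝ), (0 : X)) = 0 := he0
    simp [c, this]
  have hcd : HasDerivAt c v 0 := by
    have h1 : HasFDerivAt e.symm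
        ((ContinuousLinearEquiv.refl ℝ (ℝ × X)).symm : ℝ × X →L[ℝ] ℝ × X) ((0 : ℝ), (0 : X)) :=
      e.hasFDerivAt_symm het (by
        have h : e.symm ((0 : ℝ), (0 : X)) = 0 := he0
        rw [h]; exact hΘd)
    have h2 : HasDerivAt (fun t : ℝ => ((t, 0) : ℝ × X)) ((1 : ℝ), (0 : X)) 0 :=
      (hasDerivAt_id 0).prodMk (hasDerivAt_const 0 0)
    have h3 := h1.comp_hasDerivAt (0 : ℝ) h2
    have h4 := (s.comp (ContinuousLinearMap.snd ℝ ℝ X)).hasFDerivAt.comp_hasDerivAt (0 : ℝ) h3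
    have h5 := (((hasDerivAt_id (0 : ℝ)).smul_const v).add h4).const_add p
    refine (h5.congr_deriv ?_ : HasDerivAt c _ 0)
    simp
  obtain ⟨γ, hγ, hγc⟩ := exists_contDiff_eventuallyEq hcs
  refine ⟨γ, hγ, ?_, ?_, ?_⟩
  · filter_upwards [hcM, hγc] with t h1 h2
    rwa [h2]
  · rw [hγc.self_of_nhds, hc0]
  · rw [hγc.deriv_eq, hcd.deriv]

theorem fderiv_eq_zero_of_mem_tangentVectors {M U : Set E} {G : E → X} {p v : E}
    (hU : IsOpen U) (hp : p ∈ U) (hG : ContDiffOn ℝ ∞ G U)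
    (hM : ∀ x ∈ U, x ∈ M → G x = 0) (hv : v ∈ tangentVectors M p) : fderiv ℝ G p v = 0 := by
  obtain ⟨γ, hγ, hγM, hγ0, hγv⟩ := hv
  have h1 : HasDerivAt γ v 0 := by
    rw [← hγv]; exact (hγ.differentiable (by simp)).differentiableAt.hasDerivAt
  have h2 : HasFDerivAt G (fderiv ℝ G p) (γ 0) := by
    rw [hγ0]
    exact ((hG.contDiffAt (hU.mem_nhds hp)).differentiableAt (by simp)).hasFDerivAt
  have h3 := h2.comp_hasDerivAt (0 : ℝ) h1
  have h4 : G ∘ γ =ᶠ[𝓝 0] fun _ => (0 : X) := by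
    have : ∀ᶠ t in 𝓝 (0 : ℝ), γ t ∈ U :=
      hγ.continuous.continuousAt.eventually (by rw [hγ0]; exact hU.mem_nhds hp)
    filter_upwards [hγM, this] with t h5 h6
    exact hM _ h6 h5
  rw [← h3.deriv, h4.deriv_eq, deriv_const]

theorem tangentVectors_mono {M N : Set E} (h : M ⊆ N) (p : E) :
    tangentVectors M p ⊆ tangentVectors N p := by
  rintro v ⟨γ, h1, h2, h3⟩
  exact ⟨γ, h1, h2.mono fun _ ht => h ht, h3⟩

/-- Local regular level sets of maps into a fixed finite-dimensional space form an embedded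
submanifold. -/
theorem isEmbeddedSubmanifold_of_level (X : Type*) [NormedAddCommGroup X] [NormedSpace ℝ X]
    [FiniteDimensional ℝ X] {M : Set E}
    (h : ∀ p ∈ M, ∃ (U : Set E) (G : E → X), IsOpen U ∧ p ∈ U ∧ ContDiffOn ℝ ∞ G U ∧
      Function.Surjective (fderiv ℝ G p) ∧ ∀ x ∈ U, x ∈ M ↔ G x = 0) :
    IsEmbeddedSubmanifold M := by
  let e : X ≃L[ℝ] (Fin (Module.finrank ℝ X) → ℝ) :=
    ContinuousLinearEquiv.ofFinrankEq (by simp)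
  refine ⟨Module.finrank ℝ X, fun p hp => ?_⟩
  obtain ⟨U, G, hU, hpU, hG, hs, hM⟩ := h p hp
  refine ⟨U, e ∘ G, hU, hpU, e.contDiff.comp_contDiffOn hG, ?_, fun x hx => ?_⟩
  · rw [e.comp_fderiv]
    exact e.surjective.comp hs
  · rw [hM x hx]
    simp

end LevelSets

/-! ### Frames, index ranges and cones over subsets of projective space. -/

section Frames

variable {W : Type*} [NormedAddCommGroup W] [NormedSpace ℂ W] {m : ℕ}

theorem eq_zero_or_mid_or_last (a : Fin (m + 1)) :
    a = 0 ∨ (∃ α : Mid m, a = α) ∨ a = Fin.last m := by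
  by_cases h0 : a = 0
  · exact Or.inl h0
  by_cases h1 : a = Fin.last m
  · exact Or.inr (Or.inr h1)
  · exact Or.inr (Or.inl ⟨⟨a, Fin.pos_iff_ne_zero.2 h0, lt_of_le_of_ne (Fin.le_last a) h1⟩, rfl⟩)

theorem Mid.ne_zero (α : Mid m) : (α : Fin (m + 1)) ≠ 0 := α.2.1.ne'

theorem Mid.ne_last (α : Mid m) : (α : Fin (m + 1)) ≠ Fin.last m := α.2.2.ne

theorem last_ne_zero (hm : 1 ≤ m) : Fin.last m ≠ 0 := by
  intro h
  have := congrArg Fin.val h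
  simp at this
  omega

theorem sum_eq_zero_add_mid_add_last {A : Type*} [AddCommMonoid A] (hm : 1 ≤ m)
    (g : Fin (m + 1) → A) :
    ∑ b, g b = g 0 + ∑ β : Mid m, g β + g (Fin.last m) := by
  have h1 : ∑ β : Mid m, g β =
      ∑ b ∈ Finset.univ.filter (fun a : Fin (m + 1) => 0 < a ∧ a < Fin.last m), g b :=
    (Finset.sum_subtype _ (by simp) g).symm
  have h2 : (Finset.univ : Finset (Fin (m + 1))) = insert 0 (insert (Fin.last m)
      (Finset.univ.filter (fun a : Fin (m + 1) => 0 < a ∧ a < Fin.last m))) := by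
    ext a
    rcases eq_zero_or_mid_or_last a with h | ⟨α, rfl⟩ | h
    · simp [h]
    · simp [α.2]
    · simp [h]
  rw [h1, congrArg (fun s => ∑ b ∈ s, g b) h2, Finset.sum_insert, Finset.sum_insert]
  · rw [add_assoc, add_comm (g (Fin.last m))]
  · simp
  · simpa using (last_ne_zero hm).symm

theorem mem_frames_iff [FiniteDimensional ℂ W] (hW : Module.finrank ℂ W = m + 1)
    {f : Fin (m + 1) → W} : f ∈ frames W m ↔ LinearIndependent ℂ f :=
  ⟨fun h => h.1, fun h => ⟨h, (h.span_eq_top_of_card_eq_finrank' (by simp [hW])).ge⟩⟩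

theorem isOpen_frames [FiniteDimensional ℂ W] (hW : Module.finrank ℂ W = m + 1) :
    IsOpen (frames W m) := by
  have : frames W m = {f | LinearIndependent ℂ f} := Set.ext fun f => mem_frames_iff hW
  rw [this]
  exact isOpen_setOfPred_linearIndependent

theorem maurerCartan_eq {f v : Fin (m + 1) → W} (hf : f ∈ frames W m) {a : Fin (m + 1)}
    {c : Fin (m + 1) → ℂ} (h : v a = ∑ b, c b • f b) (b : Fin (m + 1)) :
    maurerCartan f v b a = c b := by
  have h1 := maurerCartan_spec hf v a
  rw [h] at h1
  have h2 := Fintype.linearIndependent_iff.1 hf.1 (fun b => maurerCartan f v b a - c b)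
    (by simp only [sub_smul, Finset.sum_sub_distrib, ← h1, sub_self]) b
  exact sub_eq_zero.1 h2

theorem smul_mem_cone {S : Set (ℙ ℂ W)} {w : W} (hw : w ∈ cone S) {c : ℂ} (hc : c ≠ 0) :
    c • w ∈ cone S := by
  obtain ⟨h, hS⟩ := hw
  refine ⟨smul_ne_zero hc h, ?_⟩
  rwa [(Projectivization.mk_eq_mk_iff' ℂ (c • w) w (smul_ne_zero hc h) h).2 ⟨c, rfl⟩]

theorem mem_cone_singleton_iff {x : ℙ ℂ W} {w : W} :
    w ∈ cone {x} ↔ ∃ c : ℂ, c ≠ 0 ∧ w = c • x.rep := by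
  constructor
  · rintro ⟨h, hx⟩
    rw [Set.mem_singleton_iff, ← x.mk_rep, Projectivization.mk_eq_mk_iff'] at hx
    obtain ⟨c, hc⟩ := hx
    exact ⟨c, by rintro rfl; exact h (by simpa using hc.symm), hc.symm⟩
  · rintro ⟨c, hc, rfl⟩
    exact smul_mem_cone ⟨x.rep_nonzero, by simp⟩ hc

theorem rep_mem_cone {S : Set (ℙ ℂ W)} {x : ℙ ℂ W} : x.rep ∈ cone S ↔ x ∈ S := by
  constructor
  · rintro ⟨h, hx⟩
    rwa [x.mk_rep] at hx
  · exact fun h => ⟨x.rep_nonzero, by rwa [x.mk_rep]⟩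

/-- A set of nonzero vectors which is stable under scaling is a cone. -/
theorem exists_cone_eq {C : Set W} (h0 : ∀ w ∈ C, w ≠ 0)
    (hC : ∀ c : ℂ, c ≠ 0 → ∀ w ∈ C, c • w ∈ C) : ∃ U : Set (ℙ ℂ W), cone U = C := by
  refine ⟨{x | x.rep ∈ C}, Set.ext fun w => ⟨?_, fun hw => ⟨h0 w hw, ?_⟩⟩⟩
  · rintro ⟨h, hx⟩
    obtain ⟨a, ha⟩ := Projectivization.exists_smul_eq_mk_rep ℂ w h
    have h1 := hC (a⁻¹ : ℂˣ) (Units.ne_zero _) _ hx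
    rw [← ha] at h1
    simpa [Units.smul_def, smul_smul] using h1
  · obtain ⟨a, ha⟩ := Projectivization.exists_smul_eq_mk_rep ℂ w (h0 w hw)
    rw [Set.mem_ofPred_eq, ← ha]
    exact hC a a.ne_zero w hw

theorem mem_cone_inter {S U : Set (ℙ ℂ W)} {w : W} :
    w ∈ cone (S ∩ U) ↔ w ∈ cone S ∧ w ∈ cone U :=
  ⟨fun ⟨h, h1, h2⟩ => ⟨⟨h, h1⟩, ⟨h, h2⟩⟩, fun ⟨⟨h, h1⟩, ⟨_, h2⟩⟩ => ⟨h, h1, h2⟩⟩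

end Frames

/-! ### Complex-linear forms with prescribed real part. -/

section ComplexLift

variable {W : Type*} [NormedAddCommGroup W] [NormedSpace ℂ W]

variable (W) in
/-- The complex-linear extension `v ↦ A v - i A (i v)` of a real linear form `A`. -/
def complexLift : (W →L[ℝ] ℝ) →L[ℝ] (W →L[ℝ] ℂ) :=
  ContinuousLinearMap.compL ℝ W ℝ ℂ Complex.ofRealCLM -
    (ContinuousLinearMap.compL ℝ W ℝ ℂ (Complex.I • Complex.ofRealCLM)).comp
      ((ContinuousLinearMap.compL ℝ W W ℝ).flip (Complex.I • ContinuousLinearMap.id ℝ W))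

theorem complexLift_apply (A : W →L[ℝ] ℝ) (v : W) :
    complexLift W A v = A v - Complex.I * A (Complex.I • v) := by
  simp [complexLift]

theorem complexLift_re (A : W →L[ℝ] ℝ) (v : W) : (complexLift W A v).re = A v := by
  simp [complexLift_apply]

theorem complexLift_smul (A : W →L[ℝ] ℝ) (c : ℂ) (v : W) :
    complexLift W A (c • v) = c * complexLift W A v := by
  have h1 : ∀ r : ℝ, ∀ u : W, A ((r : ℂ) • u) = r * A u := fun r u => by
    rw [Complex.coe_smul, map_smul, smul_eq_mul]
  have h2 : c • v = (c.re : ℂ) • v + (c.im : ℂ) • (Complex.I • v) := by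
    conv_lhs => rw [← Complex.re_add_im c]
    rw [add_smul, mul_smul]
  have h3 : Complex.I • c • v = (c.re : ℂ) • (Complex.I • v) + ((-c.im : ℝ) : ℂ) • v := by
    rw [h2, smul_add, smul_comm, smul_comm Complex.I (c.im : ℂ), smul_smul Complex.I Complex.I]
    simp
  rw [complexLift_apply, complexLift_apply, h3, h2]
  simp only [map_add, h1]
  apply Complex.ext
  · simp
  · simp
    ring

theorem complexLift_injective {A : W →L[ℝ] ℝ} (h : ∀ v, complexLift W A v = 0) : A = 0 := by
  ext v
  rw [← complexLift_re, h]
  simp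

theorem complexLift_sum (A : W →L[ℝ] ℝ) {ι : Type*} (s : Finset ι) (c : ι → ℂ) (g : ι → W) :
    complexLift W A (∑ i ∈ s, c i • g i) = ∑ i ∈ s, c i * complexLift W A (g i) := by
  simp only [map_sum, complexLift_smul]

end ComplexLift

/-! ### Homogeneous defining functions and their first two derivatives. -/

section Defining

variable {W : Type*} [NormedAddCommGroup W] [NormedSpace ℂ W]

/-- `ρ` is a defining function of the cone over `S` on the open cone `C`, constant on complex
lines. -/
structure IsDefining (S : Set (ℙ ℂ W)) (C : Set W) (ρ : W → ℝ) : Prop where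
  isOpen : IsOpen C
  ne_zero : ∀ w ∈ C, w ≠ 0
  smul_mem : ∀ c : ℂ, c ≠ 0 → ∀ w ∈ C, c • w ∈ C
  smooth : ContDiffOn ℝ ∞ ρ C
  smul_eq : ∀ c : ℂ, c ≠ 0 → ∀ w ∈ C, ρ (c • w) = ρ w
  regular : ∀ w ∈ C, w ∈ cone S → fderiv ℝ ρ w ≠ 0
  mem_iff : ∀ w ∈ C, w ∈ cone S ↔ ρ w = 0

theorem IsCRHypersurface.exists_isDefining {S : Set (ℙ ℂ W)} (hS : IsCRHypersurface S) {w : W}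
    (hw : w ∈ cone S) : ∃ (C : Set W) (ρ : W → ℝ), IsDefining S C ρ ∧ w ∈ C := by
  obtain ⟨h0, hz⟩ := hw
  obtain ⟨U, r, hU, hzU, hr, hreg, hSU⟩ := hS _ hz
  have hp : ∀ w (h : w ≠ 0), pullback r w = r (Projectivization.mk ℂ w h) := fun w h => by
    simp [pullback, h]
  refine ⟨cone U, pullback r, ⟨hU, fun w h => h.1, fun c hc w h => smul_mem_cone h hc, hr, ?_, ?_,
    ?_⟩, ⟨h0, hzU⟩⟩
  · rintro c hc w ⟨h, -⟩
    rw [hp _ h, hp _ (smul_ne_zero hc h),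
      (Projectivization.mk_eq_mk_iff' ℂ (c • w) w (smul_ne_zero hc h) h).2 ⟨c, rfl⟩]
  · exact fun w h h' => hreg w (mem_cone_inter.2 ⟨h', h⟩)
  · rintro w ⟨h, hx⟩
    rw [hp _ h, ← hSU _ hx]
    exact ⟨fun ⟨_, h⟩ => h, fun h' => ⟨h, h'⟩⟩

/-- The `(1,0)`-part `v ↦ dρ(v) - i dρ(iv)` of the differential of `ρ`. -/
def cform (ρ : W → ℝ) (w : W) : W →L[ℝ] ℂ :=
  complexLift W (fderiv ℝ ρ w)

/-- The derivative of `cform ρ`. -/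
def chess (ρ : W → ℝ) (w : W) : W →L[ℝ] W →L[ℝ] ℂ :=
  (complexLift W).comp (fderiv ℝ (fderiv ℝ ρ) w)

theorem cform_re (ρ : W → ℝ) (w v : W) : (cform ρ w v).re = fderiv ℝ ρ w v :=
  complexLift_re _ _

theorem cform_smul (ρ : W → ℝ) (w : W) (c : ℂ) (v : W) :
    cform ρ w (c • v) = c * cform ρ w v :=
  complexLift_smul _ _ _

theorem chess_smul (ρ : W → ℝ) (w u : W) (c : ℂ) (v : W) :
    chess ρ w u (c • v) = c * chess ρ w u v :=
  complexLift_smul _ _ _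

theorem chess_re (ρ : W → ℝ) (w u v : W) :
    (chess ρ w u v).re = fderiv ℝ (fderiv ℝ ρ) w u v :=
  complexLift_re _ _

theorem chess_apply (ρ : W → ℝ) (w u v : W) :
    chess ρ w u v = fderiv ℝ (fderiv ℝ ρ) w u v -
      Complex.I * fderiv ℝ (fderiv ℝ ρ) w u (Complex.I • v) :=
  complexLift_apply _ _

variable {S : Set (ℙ ℂ W)} {C : Set W} {ρ : W → ℝ}

namespace IsDefining

theorem contDiffOn_fderiv (h : IsDefining S C ρ) : ContDiffOn ℝ ∞ (fderiv ℝ ρ) C :=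
  h.smooth.fderiv_of_isOpen h.isOpen (by simp)

theorem contDiffOn_cform (h : IsDefining S C ρ) : ContDiffOn ℝ ∞ (cform ρ) C :=
  (complexLift W).contDiff.comp_contDiffOn h.contDiffOn_fderiv

theorem contDiffOn_hess (h : IsDefining S C ρ) :
    ContDiffOn ℝ ∞ (fderiv ℝ (fderiv ℝ ρ)) C :=
  h.contDiffOn_fderiv.fderiv_of_isOpen h.isOpen (by simp)

theorem contDiffOn_chess (h : IsDefining S C ρ) : ContDiffOn ℝ ∞ (chess ρ) C :=
  contDiffOn_const.clm_comp h.contDiffOn_hess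

theorem hasFDerivAt (h : IsDefining S C ρ) {w : W} (hw : w ∈ C) :
    HasFDerivAt ρ (fderiv ℝ ρ w) w :=
  ((h.smooth.contDiffAt (h.isOpen.mem_nhds hw)).differentiableAt (by simp)).hasFDerivAt

theorem hasFDerivAt_fderiv (h : IsDefining S C ρ) {w : W} (hw : w ∈ C) :
    HasFDerivAt (fderiv ℝ ρ) (fderiv ℝ (fderiv ℝ ρ) w) w :=
  ((h.contDiffOn_fderiv.contDiffAt (h.isOpen.mem_nhds hw)).differentiableAt (by simp)).hasFDerivAt

theorem hasFDerivAt_cform (h : IsDefining S C ρ) {w : W} (hw : w ∈ C) :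
    HasFDerivAt (cform ρ) (chess ρ w) w :=
  (complexLift W).hasFDerivAt.comp w (h.hasFDerivAt_fderiv hw)

theorem hess_symm (h : IsDefining S C ρ) {w : W} (hw : w ∈ C) (u v : W) :
    fderiv ℝ (fderiv ℝ ρ) w u v = fderiv ℝ (fderiv ℝ ρ) w v u :=
  (h.smooth.contDiffAt (h.isOpen.mem_nhds hw)).isSymmSndFDerivAt
    (by simp only [minSmoothness_of_isRCLikeNormedField]; exact WithTop.coe_le_coe.2 le_top) u v

/-- Differentiating `ρ (c • w) = ρ w` gives `dρ` at `c • w` applied to `c • u` equal to `dρ` at `w`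
applied to `u`; complex linearity then extracts `c`. -/
theorem cform_smul_left (h : IsDefining S C ρ) {w : W} (hw : w ∈ C) {c : ℂ} (hc : c ≠ 0)
    (v : W) : cform ρ (c • w) v = c⁻¹ * cform ρ w v := by
  have key : ∀ u, fderiv ℝ ρ (c • w) (c • u) = fderiv ℝ ρ w u := by
    intro u
    have h1 : HasFDerivAt (fun x : W => c • x) (c • ContinuousLinearMap.id ℝ W) w :=
      (c • ContinuousLinearMap.id ℝ W).hasFDerivAt
    have h2 := (h.hasFDerivAt (h.smul_mem c hc w hw)).comp w h1
    have h3 : HasFDerivAt (ρ ∘ fun x : W => c • x) (fderiv ℝ ρ w) w := by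
      refine (h.hasFDerivAt hw).congr_of_eventuallyEq ?_
      filter_upwards [h.isOpen.mem_nhds hw] with x hx
      exact h.smul_eq c hc x hx
    exact DFunLike.congr_fun (h2.unique h3) u
  have h4 : cform ρ (c • w) (c • v) = cform ρ w v := by
    rw [cform, cform, complexLift_apply, complexLift_apply, key, smul_comm, key]
  rw [← h4, cform_smul, inv_mul_cancel_left₀ hc]

theorem eventually_one_add_ne (s : ℂ) : ∀ᶠ t : ℝ in 𝓝 0, 1 + (t : ℂ) * s ≠ 0 := by
  have h : Continuous fun t : ℝ => 1 + (t : ℂ) * s := by fun_prop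
  exact h.continuousAt.eventually_ne (by simp)

theorem hasDerivAt_line (s : ℂ) (w : W) :
    HasDerivAt (fun t : ℝ => (1 + (t : ℂ) * s) • w) (s • w) 0 := by
  have h1 : HasDerivAt (fun t : ℝ => 1 + (t : ℂ) * s) s 0 := by
    simpa using ((Complex.ofRealCLM.hasDerivAt (x := (0 : ℝ))).mul_const s).const_add 1
  exact h1.smul_const w

theorem cform_self (h : IsDefining S C ρ) {w : W} (hw : w ∈ C) : cform ρ w w = 0 := by
  have key : ∀ s : ℂ, fderiv ℝ ρ w (s • w) = 0 := by
    intro s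
    have h1 : HasFDerivAt ρ (fderiv ℝ ρ w) ((1 + ((0 : ℝ) : ℂ) * s) • w) := by
      simpa using h.hasFDerivAt hw
    have h2 := h1.comp_hasDerivAt (0 : ℝ) (hasDerivAt_line s w)
    have h3 : HasDerivAt (ρ ∘ fun t : ℝ => (1 + (t : ℂ) * s) • w) 0 0 := by
      refine (hasDerivAt_const (0 : ℝ) (ρ w)).congr_of_eventuallyEq ?_
      filter_upwards [eventually_one_add_ne s] with t ht
      exact h.smul_eq _ ht w hw
    exact h2.unique h3
  have h1 := key 1
  rw [one_smul] at h1
  rw [cform, complexLift_apply, key, h1]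
  simp

/-- Euler's relation for the degree `-1` homogeneity of `cform`, by differentiating along `t ↦ (1 +
t s) • w`. -/
theorem chess_smul_self (h : IsDefining S C ρ) {w : W} (hw : w ∈ C) (s : ℂ) (v : W) :
    chess ρ w (s • w) v = -s * cform ρ w v := by
  have h1 : HasFDerivAt (cform ρ) (chess ρ w) ((1 + ((0 : ℝ) : ℂ) * s) • w) := by
    simpa using h.hasFDerivAt_cform hw
  have h2 : HasDerivAt (fun t : ℝ => cform ρ ((1 + (t : ℂ) * s) • w) v)
      (chess ρ w (s • w) v) 0 := by
    have h5 : HasDerivAt (fun t : ℝ => cform ρ ((1 + (t : ℂ) * s) • w)) (chess ρ w (s • w)) 0 := by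
      have h6 := h1.comp_hasDerivAt (0 : ℝ) (hasDerivAt_line s w)
      exact h6
    simpa using h5.clm_apply (hasDerivAt_const (0 : ℝ) v)
  have h3 : HasDerivAt (fun t : ℝ => (1 + (t : ℂ) * s)⁻¹ * cform ρ w v)
      (-s * cform ρ w v) 0 := by
    have h1 : HasDerivAt (fun t : ℝ => 1 + (t : ℂ) * s) s 0 := by
      simpa using ((Complex.ofRealCLM.hasDerivAt (x := (0 : ℝ))).mul_const s).const_add 1
    have := (h1.fun_inv (by simp)).mul_const (cform ρ w v)
    simpa using this
  have h4 : HasDerivAt (fun t : ℝ => cform ρ ((1 + (t : ℂ) * s) • w) v)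
      (-s * cform ρ w v) 0 := by
    refine h3.congr_of_eventuallyEq ?_
    filter_upwards [eventually_one_add_ne s] with t ht
    exact h.cform_smul_left hw ht v
  exact h2.unique h4

end IsDefining

end Defining

/-! ### The complex Hessian and local equations for adapted frames. -/

section LocalEquations

variable {W : Type*} [NormedAddCommGroup W] [NormedSpace ℂ W] {m : ℕ}

/-- The complex bilinear part of the complex Hessian. -/
def holHess (ρ : W → ℝ) (w u v : W) : ℂ :=
  (chess ρ w u v - Complex.I * chess ρ w (Complex.I • u) v) / 2

/-- The sesquilinear part of the complex Hessian (the Levi form). -/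
def leviForm (ρ : W → ℝ) (w u v : W) : ℂ :=
  (chess ρ w u v + Complex.I * chess ρ w (Complex.I • u) v) / 2

/-- `chess` is complex-linear in its last argument but only real-linear in `u`; `holHess` and
`leviForm` are its linear and antilinear parts in `u`. They give rise to the terms in `Ω^β_0` and in
its conjugate. -/
theorem chess_smul_left (ρ : W → ℝ) (w : W) (c : ℂ) (u v : W) :
    chess ρ w (c • u) v = c * holHess ρ w u v + conj c * leviForm ρ w u v := by
  have h2 : c • u = c.re • u + c.im • (Complex.I • u) := by
    conv_lhs => rw [← Complex.re_add_im c]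
    rw [add_smul, mul_smul, Complex.coe_smul, Complex.coe_smul]
  rw [h2, map_add, map_smul, map_smul, holHess, leviForm]
  conv_rhs => rw [← Complex.re_add_im c]
  simp only [add_apply, smul_apply, Complex.real_smul,
    map_add, map_mul, Complex.conj_ofReal, Complex.conj_I]
  linear_combination (c.im : ℂ) * chess ρ w (Complex.I • u) v * Complex.I_mul_I

theorem holHess_add_leviForm (ρ : W → ℝ) (w u v : W) :
    holHess ρ w u v + leviForm ρ w u v = chess ρ w u v := by
  rw [holHess, leviForm]
  ring

variable {S : Set (ℙ ℂ W)} {C : Set W} {ρ : W → ℝ}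

namespace IsDefining

theorem holHess_symm (h : IsDefining S C ρ) {w : W} (hw : w ∈ C) (u v : W) :
    holHess ρ w u v = holHess ρ w v u := by
  simp only [holHess, chess_apply]
  rw [h.hess_symm hw v u, h.hess_symm hw v (Complex.I • u), h.hess_symm hw (Complex.I • v) u,
    h.hess_symm hw (Complex.I • v) (Complex.I • u)]
  ring

theorem conj_leviForm (h : IsDefining S C ρ) {w : W} (hw : w ∈ C) (u v : W) :
    conj (leviForm ρ w u v) = leviForm ρ w v u := by
  simp only [leviForm, chess_apply]
  rw [h.hess_symm hw v u, h.hess_symm hw v (Complex.I • u), h.hess_symm hw (Complex.I • v) u,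
    h.hess_symm hw (Complex.I • v) (Complex.I • u)]
  simp only [map_div₀, map_add, map_sub, map_mul, Complex.conj_ofReal, Complex.conj_I,
    Complex.conj_ofNat]
  ring

theorem holHess_self_left (h : IsDefining S C ρ) {w : W} (hw : w ∈ C) (v : W) :
    holHess ρ w w v = -cform ρ w v := by
  have h1 := h.chess_smul_self hw 1 v
  rw [one_smul] at h1
  rw [holHess, h.chess_smul_self hw, h1]
  linear_combination (1 / 2) * cform ρ w v * Complex.I_mul_I

theorem leviForm_self_left (h : IsDefining S C ρ) {w : W} (hw : w ∈ C) (v : W) :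
    leviForm ρ w w v = 0 := by
  have h1 := h.chess_smul_self hw 1 v
  rw [one_smul] at h1
  rw [leviForm, h.chess_smul_self hw, h1]
  linear_combination -(1 / 2) * cform ρ w v * Complex.I_mul_I

theorem chess_self_right (h : IsDefining S C ρ) {w : W} (hw : w ∈ C) (u : W) :
    chess ρ w u w = -cform ρ w u := by
  rw [← holHess_add_leviForm, h.holHess_symm hw, h.holHess_self_left hw, ← h.conj_leviForm hw,
    h.leviForm_self_left hw]
  simp

theorem surjective_fderiv (h : IsDefining S C ρ) {w : W} (hw : w ∈ C) (hS : w ∈ cone S) :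
    Function.Surjective (fderiv ℝ ρ w) := by
  have : (fderiv ℝ ρ w : W →ₗ[ℝ] ℝ) ≠ 0 := fun h0 => h.regular w hw hS
    (ContinuousLinearMap.ext fun v => LinearMap.congr_fun h0 v)
  exact LinearMap.surjective this

theorem tangentVectors_cone [FiniteDimensional ℂ W] (h : IsDefining S C ρ) {w : W} (hw : w ∈ C)
    (hS : w ∈ cone S) : tangentVectors (cone S) w = {v | fderiv ℝ ρ w v = 0} := by
  have : FiniteDimensional ℝ W := FiniteDimensional.complexToReal W
  ext v
  exact ⟨fderiv_eq_zero_of_mem_tangentVectors h.isOpen hw h.smooth fun x hx => (h.mem_iff x hx).1,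
    mem_tangentVectors_of_fderiv_eq_zero h.isOpen hw h.smooth h.mem_iff hS
      (h.surjective_fderiv hw hS)⟩

end IsDefining

theorem cform_eq_zero_iff {w v : W} :
    cform ρ w v = 0 ↔ fderiv ℝ ρ w v = 0 ∧ fderiv ℝ ρ w (Complex.I • v) = 0 := by
  rw [cform, complexLift_apply, Complex.ext_iff]
  simp

theorem cform_sum (w : W) {ι : Type*} (s : Finset ι) (c : ι → ℂ) (g : ι → W) :
    cform ρ w (∑ i ∈ s, c i • g i) = ∑ i ∈ s, c i * cform ρ w (g i) :=
  complexLift_sum _ _ _ _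

/-- The local equations satisfied by the adapted frames, besides `ρ (f 0) = 0`. -/
structure IsLocallyAdapted (ρ : W → ℝ) (f : Fin (m + 1) → W) : Prop where
  frame : f ∈ frames W m
  mid : ∀ α : Mid m, cform ρ (f 0) (f α) = 0
  last : fderiv ℝ ρ (f 0) (f (Fin.last m)) = 0

theorem IsLocallyAdapted.re_last {f : Fin (m + 1) → W} (hf : IsLocallyAdapted ρ f) :
    (cform ρ (f 0) (f (Fin.last m))).re = 0 := by
  rw [cform_re, hf.last]

theorem IsLocallyAdapted.conj_last {f : Fin (m + 1) → W} (hf : IsLocallyAdapted ρ f) :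
    conj (cform ρ (f 0) (f (Fin.last m))) = -cform ρ (f 0) (f (Fin.last m)) :=
  Complex.ext (by simp [hf.re_last]) (by simp)

namespace IsDefining

theorem cform_of_sum (h : IsDefining S C ρ) (hm : 1 ≤ m) {f : Fin (m + 1) → W} (h0 : f 0 ∈ C)
    (hf : ∀ α : Mid m, cform ρ (f 0) (f α) = 0) (c : Fin (m + 1) → ℂ) :
    cform ρ (f 0) (∑ b, c b • f b) =
      c (Fin.last m) * cform ρ (f 0) (f (Fin.last m)) := by
  rw [cform_sum, sum_eq_zero_add_mid_add_last hm]
  simp [hf, h.cform_self h0]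

/-- Otherwise `cform` would vanish on a complex basis, against the regularity of `ρ`. This makes
division by `cform ρ (f 0) (f m)` possible throughout. -/
theorem cform_last_ne_zero (h : IsDefining S C ρ) (hm : 1 ≤ m) {f : Fin (m + 1) → W}
    (h0 : f 0 ∈ C) (hS : f 0 ∈ cone S) (hf : f ∈ frames W m)
    (hmid : ∀ α : Mid m, cform ρ (f 0) (f α) = 0) :
    cform ρ (f 0) (f (Fin.last m)) ≠ 0 := by
  intro hl
  refine h.regular _ h0 hS (complexLift_injective fun v => ?_)
  have h1 := maurerCartan_spec hf (fun _ => v) 0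
  change cform ρ (f 0) v = 0
  rw [h1, h.cform_of_sum hm h0 hmid, hl, mul_zero]

theorem mem_adaptedFrames_iff [FiniteDimensional ℂ W] (h : IsDefining S C ρ) (hm : 1 ≤ m)
    {f : Fin (m + 1) → W} (h0 : f 0 ∈ C) :
    f ∈ adaptedFrames S m ↔ f 0 ∈ cone S ∧ IsLocallyAdapted ρ f := by
  constructor
  · rintro ⟨hf, hS, hspan⟩
    rw [h.tangentVectors_cone h0 hS] at hspan
    have key : ∀ v ∈ Set.range f ∪ (fun a => Complex.I • f a) '' {a | a ≠ Fin.last m},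
        fderiv ℝ ρ (f 0) v = 0 := by
      intro v hv
      have : v ∈ (Submodule.span ℝ (Set.range f ∪
        (fun a => Complex.I • f a) '' {a | a ≠ Fin.last m}) : Set W) := Submodule.subset_span hv
      rwa [hspan] at this
    refine ⟨hS, hf, fun α => cform_eq_zero_iff.2 ⟨key _ (Or.inl ⟨α, rfl⟩), key _ (Or.inr ?_)⟩,
      key _ (Or.inl ⟨_, rfl⟩)⟩
    exact ⟨α, α.ne_last, rfl⟩
  · rintro ⟨hS, hf⟩
    refine ⟨hf.frame, hS, ?_⟩
    rw [h.tangentVectors_cone h0 hS]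
    have hlast := h.cform_last_ne_zero hm h0 hS hf.frame hf.mid
    have hL : ∀ a, a ≠ Fin.last m → cform ρ (f 0) (f a) = 0 := by
      intro a ha
      rcases eq_zero_or_mid_or_last a with rfl | ⟨α, rfl⟩ | h'
      · exact h.cform_self h0
      · exact hf.mid α
      · exact absurd h' ha
    apply Set.Subset.antisymm
    · intro v hv
      change v ∈ (fderiv ℝ ρ (f 0) : W →ₗ[ℝ] ℝ).ker
      revert v
      change Submodule.span ℝ _ ≤ _
      rw [Submodule.span_le]
      rintro v (⟨a, rfl⟩ | ⟨a, ha, rfl⟩)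
      · by_cases ha : a = Fin.last m
        · rw [ha]
          exact hf.last
        · exact (cform_eq_zero_iff.1 (hL a ha)).1
      · exact (cform_eq_zero_iff.1 (hL a ha)).2
    · intro v hv
      have hspec := maurerCartan_spec hf.frame (fun _ => v) 0
      set c : Fin (m + 1) → ℂ := fun b => maurerCartan f (fun _ => v) b 0
      have hv' : v = ∑ b, c b • f b := hspec
      have h1 : (c (Fin.last m) * cform ρ (f 0) (f (Fin.last m))).re = 0 := by
        rw [← h.cform_of_sum hm h0 hf.mid, ← hv', cform_re]
        exact hv
      -- A vector annihilated by `dρ` has a real coefficient on `f m`, because `cform` takes a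
      -- nonzero imaginary value there. So `i f m` is not needed to span it.
      have h2 : (c (Fin.last m)).im = 0 := by
        rw [Complex.mul_re, hf.re_last, mul_zero, zero_sub, neg_eq_zero, mul_eq_zero] at h1
        exact h1.resolve_right fun h' => hlast (Complex.ext hf.re_last h')
      rw [hv']
      refine Submodule.sum_mem _ fun b _ => ?_
      have h3 : c b • f b = (c b).re • f b + (c b).im • (Complex.I • f b) := by
        conv_lhs => rw [← Complex.re_add_im (c b)]
        rw [add_smul, mul_smul, Complex.coe_smul, Complex.coe_smul]
      rw [h3]
      refine Submodule.add_mem _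
        (Submodule.smul_mem _ _ (Submodule.subset_span (Or.inl ⟨b, rfl⟩))) ?_
      by_cases hb : b = Fin.last m
      · rw [hb, h2, zero_smul]
        exact Submodule.zero_mem _
      · exact Submodule.smul_mem _ _ (Submodule.subset_span (Or.inr ⟨b, hb, rfl⟩))

end IsDefining

/-- The map whose zero set is locally the set of adapted frames. -/
def levelMap (ρ : W → ℝ) (f : Fin (m + 1) → W) : ℝ × (Mid m → ℂ) × ℝ :=
  (ρ (f 0), fun α => cform ρ (f 0) (f α), fderiv ℝ ρ (f 0) (f (Fin.last m)))

variable (m) in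
/-- The frames with first vector in `C`. -/
def framesOver (C : Set W) : Set (Fin (m + 1) → W) :=
  {f | f ∈ frames W m ∧ f 0 ∈ C}

namespace IsDefining

theorem isOpen_framesOver [FiniteDimensional ℂ W] (h : IsDefining S C ρ)
    (hW : Module.finrank ℂ W = m + 1) : IsOpen (framesOver m C) :=
  (isOpen_frames hW).inter (h.isOpen.preimage (continuous_apply 0))

theorem mem_adaptedFrames_iff_levelMap [FiniteDimensional ℂ W] (h : IsDefining S C ρ)
    (hm : 1 ≤ m) {f : Fin (m + 1) → W} (hf : f ∈ framesOver m C) :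
    f ∈ adaptedFrames S m ↔ levelMap ρ f = 0 := by
  rw [h.mem_adaptedFrames_iff hm hf.2, h.mem_iff _ hf.2]
  simp only [levelMap, Prod.mk_eq_zero, funext_iff, Pi.zero_apply]
  exact ⟨fun h => ⟨h.1, h.2.mid, h.2.last⟩, fun h => ⟨h.1, hf.1, h.2.1, h.2.2⟩⟩

theorem contDiffOn_comp_zero {V : Type*} [NormedAddCommGroup V]
    [NormedSpace ℝ V] {g : W → V} (hg : ContDiffOn ℝ ∞ g C) :
    ContDiffOn ℝ ∞ (fun f : Fin (m + 1) → W => g (f 0)) (framesOver m C) :=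
  hg.comp (contDiff_apply ℝ W 0).contDiffOn fun _ hf => hf.2

theorem contDiffOn_levelMap (h : IsDefining S C ρ) :
    ContDiffOn ℝ ∞ (levelMap (m := m) ρ) (framesOver m C) := by
  refine (contDiffOn_comp_zero h.smooth).prodMk ((contDiffOn_pi.2 fun α => ?_).prodMk ?_)
  · exact (contDiffOn_comp_zero h.contDiffOn_cform).clm_apply (contDiff_apply ℝ W _).contDiffOn
  · exact (contDiffOn_comp_zero h.contDiffOn_fderiv).clm_apply (contDiff_apply ℝ W _).contDiffOn

theorem fderiv_levelMap (h : IsDefining S C ρ) {f : Fin (m + 1) → W} (hf : f 0 ∈ C)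
    (v : Fin (m + 1) → W) :
    fderiv ℝ (levelMap ρ) f v =
      (fderiv ℝ ρ (f 0) (v 0),
        fun α : Mid m => cform ρ (f 0) (v α) + chess ρ (f 0) (v 0) (f α),
        fderiv ℝ ρ (f 0) (v (Fin.last m)) +
          fderiv ℝ (fderiv ℝ ρ) (f 0) (v 0) (f (Fin.last m))) := by
  have hp : ∀ a : Fin (m + 1), HasFDerivAt (fun f : Fin (m + 1) → W => f a)
      (ContinuousLinearMap.proj (R := ℝ) (φ := fun _ => W) a) f := fun a => hasFDerivAt_apply a f
  have h1 := (h.hasFDerivAt hf).comp f (hp 0)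
  have h2 : HasFDerivAt (fun (f : Fin (m + 1) → W) (α : Mid m) => cform ρ (f 0) (f α)) _ f :=
    hasFDerivAt_pi.2 fun α => ((h.hasFDerivAt_cform hf).comp f (hp 0)).clm_apply (hp α)
  have h3 := ((h.hasFDerivAt_fderiv hf).comp f (hp 0)).clm_apply (hp (Fin.last m))
  have h4 : HasFDerivAt (levelMap ρ) _ f := h1.prodMk (h2.prodMk h3)
  rw [h4.fderiv]
  rfl

/-- Once `v 0` is given, multiples of `f m` in the other components absorb the Hessian terms, since
`cform` is nonzero on `f m`. This yields both the regularity of `levelMap` and tangent vectors with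
prescribed `df_0`. -/
theorem exists_lift (h : IsDefining S C ρ) {f : Fin (m + 1) → W} (hf : f 0 ∈ C)
    (hlast : cform ρ (f 0) (f (Fin.last m)) ≠ 0) (hm : 1 ≤ m) (u : W) (b : Mid m → ℂ) (c : ℝ) :
    ∃ v : Fin (m + 1) → W, v 0 = u ∧
      fderiv ℝ (levelMap ρ) f v = (fderiv ℝ ρ (f 0) u, b, c) := by
  classical
  set l := cform ρ (f 0) (f (Fin.last m))
  refine ⟨fun a => if hα : 0 < a ∧ a < Fin.last m then
    ((b ⟨a, hα⟩ - chess ρ (f 0) u (f a)) / l) • f (Fin.last m) else if a = 0 then u else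
    (((c - fderiv ℝ (fderiv ℝ ρ) (f 0) u (f (Fin.last m)) : ℝ) : ℂ) / l) • f (Fin.last m),
    by simp, ?_⟩
  rw [h.fderiv_levelMap hf]
  refine Prod.ext ?_ (Prod.ext (funext fun α => ?_) ?_)
  · simp
  · simp only [α.2, and_self, dite_true, lt_irrefl, false_and, dite_false, if_true]
    rw [cform_smul, div_mul_cancel₀ _ hlast]
    simp
  · simp only [lt_irrefl, and_false, false_and, dite_false, if_true, last_ne_zero hm, if_false]
    rw [← cform_re, cform_smul, div_mul_cancel₀ _ hlast]
    simp

theorem surjective_fderiv_levelMap (h : IsDefining S C ρ) (hm : 1 ≤ m) {f : Fin (m + 1) → W}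
    (h0 : f 0 ∈ C) (hS : f 0 ∈ cone S) (hf : IsLocallyAdapted ρ f) :
    Function.Surjective (fderiv ℝ (levelMap ρ) f) := by
  rintro ⟨a, b, c⟩
  obtain ⟨u, hu⟩ := h.surjective_fderiv h0 hS a
  obtain ⟨v, -, hv⟩ := h.exists_lift h0 (h.cform_last_ne_zero hm h0 hS hf.frame hf.mid) hm u b c
  exact ⟨v, by rw [hv, hu]⟩

theorem mem_tangentVectors_adaptedFrames_iff [FiniteDimensional ℂ W] (h : IsDefining S C ρ)
    (hm : 1 ≤ m) (hW : Module.finrank ℂ W = m + 1) {f : Fin (m + 1) → W}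
    (hf : f ∈ adaptedFrames S m) (h0 : f 0 ∈ C) {v : Fin (m + 1) → W} :
    v ∈ tangentVectors (adaptedFrames S m) f ↔ fderiv ℝ (levelMap ρ) f v = 0 := by
  have : FiniteDimensional ℝ W := FiniteDimensional.complexToReal W
  have hU := h.isOpen_framesOver hW
  have hfU : f ∈ framesOver m C := ⟨hf.1, h0⟩
  have hM : ∀ x ∈ framesOver m C, x ∈ adaptedFrames S m ↔ levelMap ρ x = 0 :=
    fun x hx => h.mem_adaptedFrames_iff_levelMap hm hx
  have hf' := (h.mem_adaptedFrames_iff hm h0).1 hf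
  exact ⟨fderiv_eq_zero_of_mem_tangentVectors hU hfU h.contDiffOn_levelMap fun x hx => (hM x hx).1,
    mem_tangentVectors_of_fderiv_eq_zero hU hfU h.contDiffOn_levelMap hM hf
      (h.surjective_fderiv_levelMap hm h0 hf'.1 hf'.2)⟩

end IsDefining

theorem isEmbeddedSubmanifold_adaptedFrames [FiniteDimensional ℂ W] (hS : IsCRHypersurface S)
    (hm : 1 ≤ m) (hW : Module.finrank ℂ W = m + 1) :
    IsEmbeddedSubmanifold (adaptedFrames S m) := by
  refine isEmbeddedSubmanifold_of_level (ℝ × (Mid m → ℂ) × ℝ) fun f hf => ?_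
  obtain ⟨C, ρ, h, h0⟩ := hS.exists_isDefining hf.2.1
  have hf' := (h.mem_adaptedFrames_iff hm h0).1 hf
  exact ⟨framesOver m C, levelMap ρ, h.isOpen_framesOver hW, ⟨hf.1, h0⟩, h.contDiffOn_levelMap,
    h.surjective_fderiv_levelMap hm h0 hf'.1 hf'.2,
    fun x hx => h.mem_adaptedFrames_iff_levelMap hm hx⟩

end LocalEquations

/-! ### Existence, uniqueness and symmetries of the second-order coefficients. -/

section Coefficients

variable {W : Type*} [NormedAddCommGroup W] [NormedSpace ℂ W] {m : ℕ}

/-- The second-order coefficients in terms of a defining function. -/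
def coeffs (ρ : W → ℝ) (f : Fin (m + 1) → W) : SecondOrder m where
  hol α β := -holHess ρ (f 0) (f β) (f α) / cform ρ (f 0) (f (Fin.last m))
  herm α β := -leviForm ρ (f 0) (f β) (f α) / cform ρ (f 0) (f (Fin.last m))
  mix α := -chess ρ (f 0) (f (Fin.last m)) (f α) / cform ρ (f 0) (f (Fin.last m))
  nor := 2 * fderiv ℝ (fderiv ℝ ρ) (f 0) (f (Fin.last m)) (f (Fin.last m)) /
    cform ρ (f 0) (f (Fin.last m))

variable {S : Set (ℙ ℂ W)} {C : Set W} {ρ : W → ℝ}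

namespace IsDefining

theorem cform_eq_maurerCartan (h : IsDefining S C ρ) (hm : 1 ≤ m) {f : Fin (m + 1) → W}
    (h0 : f 0 ∈ C) (hf : IsLocallyAdapted ρ f) (v : Fin (m + 1) → W) (a : Fin (m + 1)) :
    cform ρ (f 0) (v a) =
      maurerCartan f v (Fin.last m) a * cform ρ (f 0) (f (Fin.last m)) := by
  conv_lhs => rw [maurerCartan_spec hf.frame v a]
  exact h.cform_of_sum hm h0 hf.mid _

/-- Tangency of `v 0` to the cone says that `Ω^m_0` times a nonzero imaginary number has real part
zero. -/
theorem conj_maurerCartan_last (h : IsDefining S C ρ) (hm : 1 ≤ m) {f v : Fin (m + 1) → W}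
    (h0 : f 0 ∈ C) (hS : f 0 ∈ cone S) (hf : IsLocallyAdapted ρ f)
    (hv : fderiv ℝ (levelMap ρ) f v = 0) :
    conj (maurerCartan f v (Fin.last m) 0) = maurerCartan f v (Fin.last m) 0 := by
  have hlast := h.cform_last_ne_zero hm h0 hS hf.frame hf.mid
  rw [h.fderiv_levelMap h0] at hv
  have h1 : fderiv ℝ ρ (f 0) (v 0) = 0 := congrArg Prod.fst hv
  have h2 := h.cform_eq_maurerCartan hm h0 hf v 0
  rw [← cform_re, h2, Complex.mul_re, hf.re_last, mul_zero, zero_sub, neg_eq_zero,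
    mul_eq_zero] at h1
  exact Complex.conj_eq_iff_im.2
    (h1.resolve_right fun h' => hlast (Complex.ext hf.re_last h'))

theorem chess_of_sum (h : IsDefining S C ρ) (hm : 1 ≤ m) {f v : Fin (m + 1) → W}
    (h0 : f 0 ∈ C) (hf : f ∈ frames W m) (u : W)
    (hreal : conj (maurerCartan f v (Fin.last m) 0) = maurerCartan f v (Fin.last m) 0) :
    chess ρ (f 0) (v 0) u = -maurerCartan f v 0 0 * cform ρ (f 0) u +
      ∑ β : Mid m, (maurerCartan f v β 0 * holHess ρ (f 0) (f β) u +
        conj (maurerCartan f v β 0) * leviForm ρ (f 0) (f β) u) +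
      maurerCartan f v (Fin.last m) 0 * chess ρ (f 0) (f (Fin.last m)) u := by
  conv_lhs => rw [maurerCartan_spec hf v 0]
  simp only [map_sum, sum_apply, chess_smul_left]
  rw [sum_eq_zero_add_mid_add_last hm, hreal, h.holHess_self_left h0, h.leviForm_self_left h0,
    ← holHess_add_leviForm]
  ring

/-- With `l = cform ρ (f 0) (f m)`, the linearized equations read `Ω^m_α l + chess (df_0, f α) = 0`
and `Re (Ω^m_m l + chess (df_0, f m)) = 0`, and `df_0` is expanded by `chess_of_sum`. In the second,
adding the conjugate and using that `l` is imaginary produces the combination of `Ω^0_0` and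
`Ω^m_m`, and also the factor `2` in `nor`. -/
theorem isSecondOrder_coeffs [FiniteDimensional ℂ W] (h : IsDefining S C ρ) (hm : 1 ≤ m)
    (hW : Module.finrank ℂ W = m + 1) {f : Fin (m + 1) → W} (hfS : f ∈ adaptedFrames S m)
    (h0 : f 0 ∈ C) : IsSecondOrder S f (coeffs ρ f) := by
  obtain ⟨hS, hf⟩ := (h.mem_adaptedFrames_iff hm h0).1 hfS
  have hlast := h.cform_last_ne_zero hm h0 hS hf.frame hf.mid
  constructor
  · intro v hv α
    rw [h.mem_tangentVectors_adaptedFrames_iff hm hW hfS h0] at hv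
    have hreal := h.conj_maurerCartan_last hm h0 hS hf hv
    rw [h.fderiv_levelMap h0] at hv
    have h1 : cform ρ (f 0) (v α) + chess ρ (f 0) (v 0) (f α) = 0 :=
      congrFun (congrArg (fun x => x.2.1) hv) α
    have h2 := h.cform_eq_maurerCartan hm h0 hf v α
    rw [h2, h.chess_of_sum hm h0 hf.frame _ hreal, hf.mid, mul_zero, zero_add] at h1
    simp only [coeffs]
    rw [eq_neg_of_add_eq_zero_left h1 |> eq_div_of_mul_eq hlast, ← Finset.sum_add_distrib,
      neg_add, add_div, ← Finset.sum_neg_distrib, Finset.sum_div]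
    congr 1
    · refine Finset.sum_congr rfl fun β _ => ?_
      ring
    · ring
  · intro v hv
    rw [h.mem_tangentVectors_adaptedFrames_iff hm hW hfS h0] at hv
    have hreal := h.conj_maurerCartan_last hm h0 hS hf hv
    rw [h.fderiv_levelMap h0] at hv
    have h1 : fderiv ℝ ρ (f 0) (v (Fin.last m)) +
        fderiv ℝ (fderiv ℝ ρ) (f 0) (v 0) (f (Fin.last m)) = 0 :=
      congrArg (fun x => x.2.2) hv
    have h2 := h.cform_eq_maurerCartan hm h0 hf v (Fin.last m)
    have hconj := hf.conj_last
    have hB := h.chess_of_sum hm h0 hf.frame (v := v) (f (Fin.last m)) hreal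
    have hnor := Complex.add_conj (chess ρ (f 0) (f (Fin.last m)) (f (Fin.last m)))
    rw [chess_re] at hnor
    rw [← cform_re, ← chess_re, ← Complex.add_re, h2] at h1
    have h3 := Complex.add_conj (maurerCartan f v (Fin.last m) (Fin.last m) *
      cform ρ (f 0) (f (Fin.last m)) + chess ρ (f 0) (v 0) (f (Fin.last m)))
    rw [h1, hB] at h3
    -- Symmetry of `holHess` and Hermitian symmetry of `leviForm` recombine the coefficient of
    -- `Ω^β_0` into `chess (f m, f β)`. This is why the same `P_{αm}` occurs in both structure
    -- equations.
    have hsum : ∑ β : Mid m, (maurerCartan f v β 0 * holHess ρ (f 0) (f β) (f (Fin.last m)) +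
          conj (maurerCartan f v β 0) * leviForm ρ (f 0) (f β) (f (Fin.last m))) +
        conj (∑ β : Mid m, (maurerCartan f v β 0 * holHess ρ (f 0) (f β) (f (Fin.last m)) +
          conj (maurerCartan f v β 0) * leviForm ρ (f 0) (f β) (f (Fin.last m)))) =
        ∑ β : Mid m, chess ρ (f 0) (f (Fin.last m)) (f β) * maurerCartan f v β 0 +
        ∑ β : Mid m, conj (chess ρ (f 0) (f (Fin.last m)) (f β)) *
          conj (maurerCartan f v β 0) := by
      rw [map_sum, ← Finset.sum_add_distrib, ← Finset.sum_add_distrib]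
      refine Finset.sum_congr rfl fun β _ => ?_
      rw [← holHess_add_leviForm, ← h.conj_leviForm h0 (f β) (f (Fin.last m)),
        h.holHess_symm h0 (f (Fin.last m)) (f β)]
      simp only [map_add, map_mul, Complex.conj_conj]
      ring
    simp only [coeffs]
    simp only [map_add, map_mul, map_neg, hreal, hconj, Complex.ofReal_zero, mul_zero] at h3
    have e1 : ∑ α : Mid m, -chess ρ (f 0) (f (Fin.last m)) (f α) /
        cform ρ (f 0) (f (Fin.last m)) * maurerCartan f v α 0 =
        -(∑ β : Mid m, chess ρ (f 0) (f (Fin.last m)) (f β) * maurerCartan f v β 0) /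
          cform ρ (f 0) (f (Fin.last m)) := by
      rw [← Finset.sum_neg_distrib, Finset.sum_div]
      exact Finset.sum_congr rfl fun β _ => by ring
    have e2 : ∑ α : Mid m, conj (-chess ρ (f 0) (f (Fin.last m)) (f α) /
        cform ρ (f 0) (f (Fin.last m))) * conj (maurerCartan f v α 0) =
        (∑ β : Mid m, conj (chess ρ (f 0) (f (Fin.last m)) (f β)) *
          conj (maurerCartan f v β 0)) / cform ρ (f 0) (f (Fin.last m)) := by
      rw [Finset.sum_div]
      refine Finset.sum_congr rfl fun β _ => ?_
      rw [map_div₀, map_neg, hconj, neg_div_neg_eq]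
      ring
    rw [e1, e2]
    push_cast at hnor h3
    field_simp
    linear_combination -h3 + hsum + maurerCartan f v (Fin.last m) 0 * hnor

theorem exists_tangentVector [FiniteDimensional ℂ W] (h : IsDefining S C ρ) (hm : 1 ≤ m)
    (hW : Module.finrank ℂ W = m + 1) {f : Fin (m + 1) → W} (hfS : f ∈ adaptedFrames S m)
    (h0 : f 0 ∈ C) (z : Mid m → ℂ) (t : ℝ) : ∃ v ∈ tangentVectors (adaptedFrames S m) f,
      (∀ β : Mid m, maurerCartan f v β 0 = z β) ∧ maurerCartan f v (Fin.last m) 0 = t := by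
  obtain ⟨hS, hf⟩ := (h.mem_adaptedFrames_iff hm h0).1 hfS
  have hlast := h.cform_last_ne_zero hm h0 hS hf.frame hf.mid
  -- The prescribed `df_0`. It is tangent to the cone because `t` is real; its `f 0` component is
  -- arbitrary and taken to be zero.
  let c : Fin (m + 1) → ℂ := fun b => if hb : 0 < b ∧ b < Fin.last m then z ⟨b, hb⟩ else
    if b = 0 then 0 else t
  have hc : c (Fin.last m) = t := by simp [c, last_ne_zero hm]
  obtain ⟨v, hv0, hv⟩ := h.exists_lift h0 hlast hm (∑ b, c b • f b) 0 0
  refine ⟨v, ?_, fun β => ?_, ?_⟩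
  · rw [h.mem_tangentVectors_adaptedFrames_iff hm hW hfS h0, hv, ← cform_re,
      h.cform_of_sum hm h0 hf.mid, hc, Complex.re_ofReal_mul, hf.re_last, mul_zero]
    rfl
  · rw [maurerCartan_eq hf.frame hv0]
    simp [c, β.2]
  · rw [maurerCartan_eq hf.frame hv0, hc]

theorem isSecondOrder_unique [FiniteDimensional ℂ W] (h : IsDefining S C ρ) (hm : 1 ≤ m)
    (hW : Module.finrank ℂ W = m + 1) {f : Fin (m + 1) → W} (hfS : f ∈ adaptedFrames S m)
    (h0 : f 0 ∈ C) {P Q : SecondOrder m} (hP : IsSecondOrder S f P) (hQ : IsSecondOrder S f Q) :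
    P = Q := by
  classical
  have hex := fun z t => h.exists_tangentVector hm hW hfS h0 z t
  have key : ∀ (α : Mid m) (z : Mid m → ℂ) (t : ℝ),
      ∑ β : Mid m, P.hol α β * z β + ∑ β : Mid m, P.herm α β * conj (z β) + P.mix α * t =
      ∑ β : Mid m, Q.hol α β * z β + ∑ β : Mid m, Q.herm α β * conj (z β) + Q.mix α * t := by
    intro α z t
    obtain ⟨v, hv, h1, h2⟩ := hex z t
    have hPv := hP.mid v hv α
    rw [hQ.mid v hv α] at hPv
    simpa only [h1, h2] using hPv.symm
  have hmix : P.mix = Q.mix := funext fun α => by simpa using key α 0 1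
  -- The values `c = 1` and `c = i` separate the linear from the antilinear coefficient.
  have hsing : ∀ (α β : Mid m) (c : ℂ), P.hol α β * c + P.herm α β * conj c =
      Q.hol α β * c + Q.herm α β * conj c := by
    intro α β c
    simpa [Pi.single_apply, apply_ite] using key α (Pi.single β c) 0
  refine SecondOrder.ext ?_ ?_ hmix ?_
  · funext α β
    have h1 := hsing α β 1
    have h2 := hsing α β Complex.I
    simp only [map_one, Complex.conj_I] at h1 h2
    linear_combination (1 / 2) * h1 - (Complex.I / 2) * h2 +
      (1 / 2) * (P.hol α β - Q.hol α β - P.herm α β + Q.herm α β) * Complex.I_mul_I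
  · funext α β
    have h1 := hsing α β 1
    have h2 := hsing α β Complex.I
    simp only [map_one, Complex.conj_I] at h1 h2
    linear_combination (1 / 2) * h1 + (Complex.I / 2) * h2 -
      (1 / 2) * (P.hol α β - Q.hol α β - P.herm α β + Q.herm α β) * Complex.I_mul_I
  · obtain ⟨v, hv, h1, h2⟩ := hex 0 1
    have hPv := hP.last v hv
    rw [hQ.last v hv] at hPv
    simpa [h1, h2] using hPv.symm

end IsDefining

/-- The second-order coefficients of `S` at an adapted frame. -/
def secondOrder (S : Set (ℙ ℂ W)) (f : Fin (m + 1) → W) : SecondOrder m :=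
  -- Off the adapted frames there are no tangent vectors, every `Q` qualifies and the choice is
  -- arbitrary; only values on adapted frames matter.
  open Classical in if h : ∃ Q, IsSecondOrder S f Q then h.choose else ⟨0, 0, 0, 0⟩

namespace IsDefining

theorem secondOrder_eq [FiniteDimensional ℂ W] (h : IsDefining S C ρ) (hm : 1 ≤ m)
    (hW : Module.finrank ℂ W = m + 1) {f : Fin (m + 1) → W} (hfS : f ∈ adaptedFrames S m)
    (h0 : f 0 ∈ C) : secondOrder S f = coeffs ρ f := by
  have h1 := h.isSecondOrder_coeffs hm hW hfS h0
  have h2 : ∃ Q, IsSecondOrder S f Q := ⟨_, h1⟩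
  rw [secondOrder, dif_pos h2]
  exact h.isSecondOrder_unique hm hW hfS h0 h2.choose_spec h1

theorem isSecondOrder_iff [FiniteDimensional ℂ W] (h : IsDefining S C ρ) (hm : 1 ≤ m)
    (hW : Module.finrank ℂ W = m + 1) {f : Fin (m + 1) → W} (hfS : f ∈ adaptedFrames S m)
    (h0 : f 0 ∈ C) (Q : SecondOrder m) : IsSecondOrder S f Q ↔ Q = secondOrder S f := by
  have h1 := h.isSecondOrder_coeffs hm hW hfS h0
  rw [h.secondOrder_eq hm hW hfS h0]
  exact ⟨fun hQ => h.isSecondOrder_unique hm hW hfS h0 hQ h1, fun hQ => hQ ▸ h1⟩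

theorem coeffs_symm (h : IsDefining S C ρ) {f : Fin (m + 1) → W}
    (hf : IsLocallyAdapted ρ f) (h0 : f 0 ∈ C) :
    (∀ α β, (coeffs ρ f).hol β α = (coeffs ρ f).hol α β) ∧
    (∀ α β, conj ((coeffs ρ f).herm α β) = -(coeffs ρ f).herm β α) ∧
    conj ((coeffs ρ f).nor) = -(coeffs ρ f).nor := by
  refine ⟨fun α β => ?_, fun α β => ?_, ?_⟩
  · simp only [coeffs]
    rw [h.holHess_symm h0]
  · simp only [coeffs]
    rw [map_div₀, map_neg, hf.conj_last, h.conj_leviForm h0]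
    ring
  · simp only [coeffs]
    rw [map_div₀, hf.conj_last]
    simp only [map_mul, Complex.conj_ofReal, Complex.conj_ofNat]
    ring

theorem contDiffOn_cform_apply (h : IsDefining S C ρ) (a : Fin (m + 1)) :
    ContDiffOn ℝ ∞ (fun f : Fin (m + 1) → W => cform ρ (f 0) (f a)) (framesOver m C) :=
  (contDiffOn_comp_zero h.contDiffOn_cform).clm_apply (contDiff_apply ℝ W _).contDiffOn

theorem contDiffOn_chess_apply (h : IsDefining S C ρ) {u v : (Fin (m + 1) → W) → W} (hu : ContDiff ℝ ∞ u)
    (hv : ContDiff ℝ ∞ v) :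
    ContDiffOn ℝ ∞ (fun f : Fin (m + 1) → W => chess ρ (f 0) (u f) (v f)) (framesOver m C) :=
  ((contDiffOn_comp_zero h.contDiffOn_chess).clm_apply hu.contDiffOn).clm_apply hv.contDiffOn

end IsDefining

end Coefficients

/-! ### Smoothness of the coefficients, shifts of frames and the normalized locus. -/

section Normalization

variable {W : Type*} [NormedAddCommGroup W] [NormedSpace ℂ W] {m : ℕ}
  {S : Set (ℙ ℂ W)} {C : Set W} {ρ : W → ℝ}

variable (m) in
/-- The frames over `C` on which `coeffs ρ` is smooth. -/
def regularFrames (ρ : W → ℝ) (C : Set W) : Set (Fin (m + 1) → W) :=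
  {f | f ∈ framesOver m C ∧ cform ρ (f 0) (f (Fin.last m)) ≠ 0}

namespace IsDefining

theorem isOpen_regularFrames [FiniteDimensional ℂ W] (h : IsDefining S C ρ)
    (hW : Module.finrank ℂ W = m + 1) : IsOpen (regularFrames m ρ C) :=
  (h.contDiffOn_cform_apply (Fin.last m)).continuousOn.isOpen_inter_preimage
    (h.isOpen_framesOver hW) isOpen_compl_singleton

theorem mem_regularFrames [FiniteDimensional ℂ W] (h : IsDefining S C ρ) (hm : 1 ≤ m)
    {f : Fin (m + 1) → W} (hf : f ∈ adaptedFrames S m) (h0 : f 0 ∈ C) :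
    f ∈ regularFrames m ρ C := by
  obtain ⟨hS, hf'⟩ := (h.mem_adaptedFrames_iff hm h0).1 hf
  exact ⟨⟨hf.1, h0⟩, h.cform_last_ne_zero hm h0 hS hf'.frame hf'.mid⟩

theorem contDiffOn_div_last (h : IsDefining S C ρ) {g : (Fin (m + 1) → W) → ℂ}
    (hg : ContDiffOn ℝ ∞ g (framesOver m C)) :
    ContDiffOn ℝ ∞ (fun f => g f / cform ρ (f 0) (f (Fin.last m))) (regularFrames m ρ C) := by
  have hsub : regularFrames m ρ C ⊆ framesOver m C := fun _ hf => hf.1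
  simp only [div_eq_mul_inv]
  exact (hg.mono hsub).mul
    (((h.contDiffOn_cform_apply (Fin.last m)).mono hsub).inv fun _ hf => hf.2)

theorem contDiffOn_hol (h : IsDefining S C ρ) (α β : Mid m) :
    ContDiffOn ℝ ∞ (fun f => (coeffs ρ f).hol α β) (regularFrames m ρ C) := by
  refine h.contDiffOn_div_last (ContDiffOn.neg (ContDiffOn.div_const (ContDiffOn.sub ?_ ?_) _))
  · exact h.contDiffOn_chess_apply (contDiff_apply ℝ W _) (contDiff_apply ℝ W _)
  · exact contDiffOn_const.mul (h.contDiffOn_chess_apply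
      ((contDiff_apply ℝ W _).const_smul _) (contDiff_apply ℝ W _))

theorem contDiffOn_herm (h : IsDefining S C ρ) (α β : Mid m) :
    ContDiffOn ℝ ∞ (fun f => (coeffs ρ f).herm α β) (regularFrames m ρ C) := by
  refine h.contDiffOn_div_last (ContDiffOn.neg (ContDiffOn.div_const (ContDiffOn.add ?_ ?_) _))
  · exact h.contDiffOn_chess_apply (contDiff_apply ℝ W _) (contDiff_apply ℝ W _)
  · exact contDiffOn_const.mul (h.contDiffOn_chess_apply
      ((contDiff_apply ℝ W _).const_smul _) (contDiff_apply ℝ W _))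

theorem contDiffOn_mix (h : IsDefining S C ρ) (α : Mid m) :
    ContDiffOn ℝ ∞ (fun f => (coeffs ρ f).mix α) (regularFrames m ρ C) :=
  h.contDiffOn_div_last
    (h.contDiffOn_chess_apply (contDiff_apply ℝ W _) (contDiff_apply ℝ W _)).neg

theorem contDiffOn_nor (h : IsDefining S C ρ) :
    ContDiffOn ℝ ∞ (fun f => (coeffs ρ f).nor) (regularFrames m ρ C) := by
  refine h.contDiffOn_div_last (contDiffOn_const.mul ?_)
  refine Complex.ofRealCLM.contDiff.comp_contDiffOn
    (ContDiffOn.clm_apply (ContDiffOn.clm_apply (contDiffOn_comp_zero h.contDiffOn_hess) ?_) ?_) <;>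
  exact (contDiff_apply ℝ W _).contDiffOn

end IsDefining

/-- A function of the second-order coefficients is smooth if it is so in terms of local defining
functions. -/
theorem contDiffOn_secondOrder [FiniteDimensional ℂ W] (hS : IsCRHypersurface S) (hm : 1 ≤ m)
    (hW : Module.finrank ℂ W = m + 1) (φ : SecondOrder m → ℂ)
    (hφ : ∀ (C : Set W) (ρ : W → ℝ), IsDefining S C ρ →
      ContDiffOn ℝ ∞ (fun f => φ (coeffs ρ f)) (regularFrames m ρ C)) :
    ContDiffOn ℝ ∞ (fun f => φ (secondOrder S f)) (adaptedFrames S m) := by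
  intro f hf
  obtain ⟨C, ρ, h, h0⟩ := hS.exists_isDefining hf.2.1
  have hU := (h.isOpen_regularFrames hW).mem_nhds (h.mem_regularFrames hm hf h0)
  -- `coeffs ρ` is smooth on an open set of frames, adapted or not, and so provides a local smooth
  -- extension of the coefficients.
  refine ((hφ C ρ h).contDiffAt hU).contDiffWithinAt.congr_of_eventuallyEq_of_mem ?_ hf
  filter_upwards [self_mem_nhdsWithin, nhdsWithin_le_nhds hU] with x hx hxU
  rw [h.secondOrder_eq hm hW hx hxU.1.2]

/-- The frame obtained from `f` by adding multiples of the first vector. -/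
def shift (f : Fin (m + 1) → W) (d : Fin (m + 1) → ℂ) : Fin (m + 1) → W :=
  fun a => f a + d a • f 0

theorem shift_zero {d : Fin (m + 1) → ℂ} (hd : d 0 = 0) (f : Fin (m + 1) → W) :
    shift f d 0 = f 0 := by
  simp [shift, hd]

theorem shift_mem_frames [FiniteDimensional ℂ W] (hW : Module.finrank ℂ W = m + 1)
    {f : Fin (m + 1) → W} (hf : f ∈ frames W m) {d : Fin (m + 1) → ℂ} (hd : d 0 = 0) :
    shift f d ∈ frames W m := by
  classical
  rw [mem_frames_iff hW, Fintype.linearIndependent_iff]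
  intro c hc
  have h1 : ∑ a, (c a + if a = 0 then ∑ b, c b * d b else 0) • f a = 0 := by
    rw [← hc]
    simp only [add_smul, ite_smul, zero_smul, shift, smul_add, smul_smul,
      Finset.sum_add_distrib, Finset.sum_ite_eq', Finset.mem_univ, if_true, Finset.sum_smul]
  have h2 := Fintype.linearIndependent_iff.1 hf.1 _ h1
  have h3 : ∀ a, a ≠ 0 → c a = 0 := fun a ha => by simpa [ha] using h2 a
  have h4 : ∑ b, c b * d b = 0 := Finset.sum_eq_zero fun b _ => by
    by_cases hb : b = 0
    · rw [hb, hd, mul_zero]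
    · rw [h3 b hb, zero_mul]
  intro a
  by_cases ha : a = 0
  · simpa [ha, h4] using h2 0
  · exact h3 a ha

namespace IsDefining

theorem cform_add_smul_self (h : IsDefining S C ρ) {w : W} (hw : w ∈ C) (v : W) (c : ℂ) :
    cform ρ w (v + c • w) = cform ρ w v := by
  rw [map_add, cform_smul, h.cform_self hw, mul_zero, add_zero]

theorem isLocallyAdapted_shift [FiniteDimensional ℂ W] (h : IsDefining S C ρ)
    (hW : Module.finrank ℂ W = m + 1) {f : Fin (m + 1) → W} (h0 : f 0 ∈ C)
    (hf : IsLocallyAdapted ρ f) {d : Fin (m + 1) → ℂ} (hd : d 0 = 0) :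
    IsLocallyAdapted ρ (shift f d) := by
  refine ⟨shift_mem_frames hW hf.frame hd, fun α => ?_, ?_⟩
  · rw [shift_zero hd, shift, h.cform_add_smul_self h0, hf.mid]
  · rw [shift_zero hd, shift, ← cform_re, h.cform_add_smul_self h0, hf.re_last]

theorem chess_add_smul_self (h : IsDefining S C ρ) {w : W} (hw : w ∈ C) (u v : W) (s c : ℂ) :
    chess ρ w (u + s • w) (v + c • w) =
      chess ρ w u v - c * cform ρ w u - s * cform ρ w v := by
  simp only [map_add, add_apply, chess_smul, h.chess_smul_self hw, h.chess_self_right hw,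
    cform_smul, h.cform_self hw]
  ring

theorem coeffs_shift_mix (h : IsDefining S C ρ) {f : Fin (m + 1) → W} (h0 : f 0 ∈ C)
    (hf : IsLocallyAdapted ρ f) (hlast : cform ρ (f 0) (f (Fin.last m)) ≠ 0)
    {d : Fin (m + 1) → ℂ} (hd : d 0 = 0) (α : Mid m) :
    (coeffs ρ (shift f d)).mix α = (coeffs ρ f).mix α + d α := by
  simp only [coeffs]
  rw [shift_zero hd]
  simp only [shift]
  rw [h.cform_add_smul_self h0, h.chess_add_smul_self h0, hf.mid]
  field_simp
  ring

/-- The shift changes `chess (f m, f m)` by `-2 d_m l` with `l` imaginary. Only its real part enters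
`nor`, so the real part of `d_m` has no effect. -/
theorem coeffs_shift_nor (h : IsDefining S C ρ) {f : Fin (m + 1) → W} (h0 : f 0 ∈ C)
    (hf : IsLocallyAdapted ρ f) (hlast : cform ρ (f 0) (f (Fin.last m)) ≠ 0)
    {d : Fin (m + 1) → ℂ} (hd : d 0 = 0) :
    (coeffs ρ (shift f d)).nor =
      (coeffs ρ f).nor - 4 * Complex.I * (d (Fin.last m)).im := by
  simp only [coeffs]
  rw [shift_zero hd]
  simp only [shift]
  rw [h.cform_add_smul_self h0, ← chess_re, h.chess_add_smul_self h0, ← chess_re]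
  have h1 : cform ρ (f 0) (f (Fin.last m)) =
      (cform ρ (f 0) (f (Fin.last m))).im * Complex.I :=
    Complex.ext (by simp [hf.re_last]) (by simp)
  rw [div_eq_iff hlast, sub_mul, div_mul_cancel₀ _ hlast]
  simp only [Complex.sub_re, Complex.mul_re, hf.re_last]
  push_cast
  linear_combination (4 * Complex.I * (d (Fin.last m)).im) * h1 +
    4 * (d (Fin.last m)).im * (cform ρ (f 0) (f (Fin.last m))).im * Complex.I_mul_I

end IsDefining

/-- The multiples of the first vector which are added to a frame in order to increase the
coefficients `mix` and `nor` by the given amounts. -/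
def shiftVector (p : Mid m → ℂ) (q : ℂ) (a : Fin (m + 1)) : ℂ :=
  -- The value `-q / 4` changes `nor` by `-4i Im (-q / 4) = i Im q`, which is `q` when `q` is
  -- imaginary, as differences of `nor` are.
  if h : 0 < a ∧ a < Fin.last m then p ⟨a, h⟩ else if a = 0 then 0 else -q / 4

@[simp]
theorem shiftVector_zero (p : Mid m → ℂ) (q : ℂ) : shiftVector p q 0 = 0 := by
  simp [shiftVector]

@[simp]
theorem shiftVector_mid (p : Mid m → ℂ) (q : ℂ) (α : Mid m) : shiftVector p q α = p α := by
  simp [shiftVector, α.2]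

theorem shiftVector_last (hm : 1 ≤ m) (p : Mid m → ℂ) (q : ℂ) :
    shiftVector p q (Fin.last m) = -q / 4 := by
  simp [shiftVector, last_ne_zero hm]

section Bundle

variable [FiniteDimensional ℂ W]

theorem shift_mem_adaptedFrames (hS : IsCRHypersurface S) (hm : 1 ≤ m)
    (hW : Module.finrank ℂ W = m + 1) {f : Fin (m + 1) → W} (hf : f ∈ adaptedFrames S m)
    {d : Fin (m + 1) → ℂ} (hd : d 0 = 0) : shift f d ∈ adaptedFrames S m := by
  obtain ⟨C, ρ, h, h0⟩ := hS.exists_isDefining hf.2.1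
  obtain ⟨h1, h2⟩ := (h.mem_adaptedFrames_iff hm h0).1 hf
  rw [h.mem_adaptedFrames_iff hm (by rwa [shift_zero hd]), shift_zero hd]
  exact ⟨h1, h.isLocallyAdapted_shift hW h0 h2 hd⟩

theorem secondOrder_shift (hS : IsCRHypersurface S) (hm : 1 ≤ m)
    (hW : Module.finrank ℂ W = m + 1) {f : Fin (m + 1) → W} (hf : f ∈ adaptedFrames S m)
    {d : Fin (m + 1) → ℂ} (hd : d 0 = 0) :
    (∀ α : Mid m, (secondOrder S (shift f d)).mix α = (secondOrder S f).mix α + d α) ∧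
    (secondOrder S (shift f d)).nor =
      (secondOrder S f).nor - 4 * Complex.I * (d (Fin.last m)).im := by
  obtain ⟨C, ρ, h, h0⟩ := hS.exists_isDefining hf.2.1
  obtain ⟨-, h2⟩ := (h.mem_adaptedFrames_iff hm h0).1 hf
  have hlast := (h.mem_regularFrames hm hf h0).2
  rw [h.secondOrder_eq hm hW hf h0, h.secondOrder_eq hm hW
    (shift_mem_adaptedFrames hS hm hW hf hd) (by rwa [shift_zero hd])]
  exact ⟨fun α => h.coeffs_shift_mix h0 h2 hlast hd α, h.coeffs_shift_nor h0 h2 hlast hd⟩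

theorem secondOrder_symm (hS : IsCRHypersurface S) (hm : 1 ≤ m)
    (hW : Module.finrank ℂ W = m + 1) {f : Fin (m + 1) → W} (hf : f ∈ adaptedFrames S m) :
    (∀ α β, (secondOrder S f).hol β α = (secondOrder S f).hol α β) ∧
    (∀ α β, conj ((secondOrder S f).herm α β) = -(secondOrder S f).herm β α) ∧
    conj ((secondOrder S f).nor) = -(secondOrder S f).nor := by
  obtain ⟨C, ρ, h, h0⟩ := hS.exists_isDefining hf.2.1
  rw [h.secondOrder_eq hm hW hf h0]
  exact h.coeffs_symm ((h.mem_adaptedFrames_iff hm h0).1 hf).2 h0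

variable (S m) in
/-- The adapted frames on which the coefficients `mix` and `nor` vanish. -/
def normalFrames : Set (Fin (m + 1) → W) :=
  {f | f ∈ adaptedFrames S m ∧ (∀ α, (secondOrder S f).mix α = 0) ∧ (secondOrder S f).nor = 0}

/-- The map whose zero set is locally the set of normalized frames. -/
def normalMap (ρ : W → ℝ) (f : Fin (m + 1) → W) :
    (ℝ × (Mid m → ℂ) × ℝ) × ((Mid m → ℂ) × ℝ) :=
  -- On adapted frames `nor` is imaginary; keeping only its imaginary part leaves independent
  -- equations.
  (levelMap ρ f, ((coeffs ρ f).mix, (coeffs ρ f).nor.im))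

theorem IsDefining.mem_normalFrames_iff (h : IsDefining S C ρ) (hm : 1 ≤ m)
    (hW : Module.finrank ℂ W = m + 1) {f : Fin (m + 1) → W} (hf : f ∈ framesOver m C) :
    f ∈ normalFrames m S ↔ normalMap ρ f = 0 := by
  have h1 := h.mem_adaptedFrames_iff_levelMap hm hf
  simp only [normalMap, Prod.mk_eq_zero, ← h1]
  refine and_congr_right fun hfS => ?_
  rw [h.secondOrder_eq hm hW hfS hf.2]
  have h2 := (h.coeffs_symm ((h.mem_adaptedFrames_iff hm hf.2).1 hfS).2 hf.2).2.2
  have h3 : (coeffs ρ f).nor.re = 0 := by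
    have := congrArg Complex.re h2
    simp only [Complex.conj_re, Complex.neg_re] at this
    linarith
  rw [Complex.ext_iff, funext_iff]
  simp [h3]

/-- The differential is block triangular: shift directions leave `levelMap` equal to zero and
already reach every value of the last two components, while `levelMap` is itself regular. -/
theorem IsDefining.surjective_fderiv_normalMap (h : IsDefining S C ρ) (hm : 1 ≤ m)
    (hW : Module.finrank ℂ W = m + 1) {f : Fin (m + 1) → W} (hfS : f ∈ adaptedFrames S m)
    (h0 : f 0 ∈ C) (hN : ContDiffOn ℝ ∞ (normalMap (m := m) ρ) (regularFrames m ρ C)) :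
    Function.Surjective (fderiv ℝ (normalMap ρ) f) := by
  obtain ⟨hS, hf⟩ := (h.mem_adaptedFrames_iff hm h0).1 hfS
  have hreg := h.mem_regularFrames hm hfS h0
  have hd : HasFDerivAt (normalMap ρ) (fderiv ℝ (normalMap ρ) f) f :=
    ((hN.contDiffAt ((h.isOpen_regularFrames hW).mem_nhds hreg)).differentiableAt
      (by simp)).hasFDerivAt
  have hlev : ∀ v, (fderiv ℝ (normalMap ρ) f v).1 = fderiv ℝ (levelMap ρ) f v := by
    intro v
    have h1 : HasFDerivAt (levelMap ρ) _ f := hd.fst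
    rw [h1.fderiv]
    rfl
  have hdir : ∀ (p : Mid m → ℂ) (q : ℝ), ∃ v, fderiv ℝ (normalMap ρ) f v = (0, (p, q)) := by
    intro p q
    let d := shiftVector p (q * Complex.I)
    have hd0 : d 0 = 0 := shiftVector_zero _ _
    refine ⟨fun a => d a • f 0, ?_⟩
    have hline : HasDerivAt (fun t : ℝ => f + t • fun a => d a • f 0) (fun a => d a • f 0) 0 := by
      simpa using ((hasDerivAt_id (0 : ℝ)).smul_const (fun a => d a • f 0)).const_add f
    have h1 := HasFDerivAt.comp_hasDerivAt (0 : ℝ)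
      (f := fun t : ℝ => f + t • fun a => d a • f 0) (l := normalMap ρ) (by simpa using hd) hline
    have hshift : ∀ t : ℝ, (f + t • fun a => d a • f 0) = shift f fun a => t * d a := by
      intro t
      funext a
      simp [shift, mul_smul]
    -- Along a line of shifts `normalMap` is exactly affine, so its derivative can be read off.
    have h2 : (normalMap ρ ∘ fun t : ℝ => f + t • fun a => d a • f 0) =
        fun t => normalMap ρ f + t • ((0 : ℝ × (Mid m → ℂ) × ℝ), (p, q)) := by
      funext t
      have ht : (fun a : Fin (m + 1) => (t : ℂ) * d a) 0 = 0 := by simp [hd0]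
      simp only [Function.comp_apply, hshift, normalMap]
      refine Prod.ext ?_ (Prod.ext (funext fun α => ?_) ?_)
      · have h3 := h.isLocallyAdapted_shift hW h0 hf (d := fun a => (t : ℂ) * d a) ht
        have h4 : shift f (fun a => (t : ℂ) * d a) ∈ adaptedFrames S m := by
          rw [h.mem_adaptedFrames_iff hm (by rwa [shift_zero (d := fun a => (t : ℂ) * d a) ht]), shift_zero (d := fun a => (t : ℂ) * d a) ht]
          exact ⟨hS, h3⟩
        have h5 := (h.mem_adaptedFrames_iff_levelMap hm
          ⟨h3.frame, by rwa [shift_zero (d := fun a => (t : ℂ) * d a) ht]⟩).1 h4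
        have h6 := (h.mem_adaptedFrames_iff_levelMap hm ⟨hf.frame, h0⟩).1 hfS
        simp [h5, h6]
      · simp only [Prod.snd_add, Prod.fst_add, Pi.add_apply, Prod.smul_snd, Prod.smul_fst,
          Pi.smul_apply, Complex.real_smul]
        rw [h.coeffs_shift_mix h0 hf hreg.2 (d := fun a => (t : ℂ) * d a) ht]
        simp [d]
      · simp only [Prod.snd_add, Prod.smul_snd, smul_eq_mul]
        rw [h.coeffs_shift_nor h0 hf hreg.2 (d := fun a => (t : ℂ) * d a) ht]
        simp only [d, shiftVector_last hm]
        simp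
        ring
    have h7 : HasDerivAt (fun t : ℝ => normalMap ρ f + t • ((0 : ℝ × (Mid m → ℂ) × ℝ), (p, q)))
        ((0 : ℝ × (Mid m → ℂ) × ℝ), (p, q)) 0 := by
      simpa using ((hasDerivAt_id (0 : ℝ)).smul_const
        ((0 : ℝ × (Mid m → ℂ) × ℝ), (p, q))).const_add (normalMap ρ f)
    rw [h2] at h1
    exact h1.unique h7
  rintro ⟨x, p, q⟩
  obtain ⟨v, hv⟩ := h.surjective_fderiv_levelMap hm h0 hS hf x
  obtain ⟨u, hu⟩ := hdir (p - (fderiv ℝ (normalMap ρ) f v).2.1)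
    (q - (fderiv ℝ (normalMap ρ) f v).2.2)
  refine ⟨v + u, ?_⟩
  rw [map_add, hu]
  refine Prod.ext ?_ (Prod.ext ?_ ?_)
  · simp [hlev, hv]
  · simp
  · simp

theorem isEmbeddedSubmanifold_normalFrames (hS : IsCRHypersurface S) (hm : 1 ≤ m)
    (hW : Module.finrank ℂ W = m + 1) : IsEmbeddedSubmanifold (normalFrames m S) := by
  refine isEmbeddedSubmanifold_of_level ((ℝ × (Mid m → ℂ) × ℝ) × ((Mid m → ℂ) × ℝ))
    fun f hf => ?_
  obtain ⟨C, ρ, h, h0⟩ := hS.exists_isDefining hf.1.2.1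
  have hN : ContDiffOn ℝ ∞ (normalMap (m := m) ρ) (regularFrames m ρ C) :=
    (h.contDiffOn_levelMap.mono fun _ hf => hf.1).prodMk
      ((contDiffOn_pi.2 fun α => h.contDiffOn_mix α).prodMk
        (Complex.imCLM.contDiff.comp_contDiffOn h.contDiffOn_nor))
  exact ⟨regularFrames m ρ C, normalMap ρ, h.isOpen_regularFrames hW,
    h.mem_regularFrames hm hf.1 h0, hN, h.surjective_fderiv_normalMap hm hW hf.1 h0 hN,
    fun x hx => h.mem_normalFrames_iff hm hW hx.1⟩

end Bundle

end Normalization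

/-! ### Adapted frames through a given vector, and linear maps between nearby fibres. -/

section Trivialization

variable {W : Type*} [NormedAddCommGroup W] [NormedSpace ℂ W] {m : ℕ}
  {S : Set (ℙ ℂ W)} {C : Set W} {ρ : W → ℝ}

/-- `cform ρ w` as a complex-linear form. -/
def cformLin (ρ : W → ℝ) (w : W) : W →ₗ[ℂ] ℂ where
  toFun := cform ρ w
  map_add' := map_add _
  map_smul' c v := cform_smul ρ w c v

@[simp]
theorem cformLin_apply (ρ : W → ℝ) (w v : W) : cformLin ρ w v = cform ρ w v := rfl

theorem IsDefining.exists_cform_eq (h : IsDefining S C ρ) {w : W} (hw : w ∈ C)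
    (hS : w ∈ cone S) (c : ℂ) : ∃ e, cform ρ w e = c := by
  have : cformLin ρ w ≠ 0 := fun h0 => h.regular w hw hS
    (complexLift_injective fun v => LinearMap.congr_fun h0 v)
  exact LinearMap.surjective this c

theorem exists_mem_adaptedFrames [FiniteDimensional ℂ W] (hS : IsCRHypersurface S) (hm : 1 ≤ m)
    (hW : Module.finrank ℂ W = m + 1) {w : W} (hw : w ∈ cone S) :
    ∃ f ∈ adaptedFrames S m, f 0 = w := by
  obtain ⟨C, ρ, h, h0⟩ := hS.exists_isDefining hw
  -- A nonzero imaginary value makes `e` transverse to the kernel of `cform` and still tangent to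
  -- the cone: it can serve as `f m`.
  obtain ⟨e, he⟩ := h.exists_cform_eq h0 hw Complex.I
  let K := (cformLin ρ w).ker
  have hK : Module.finrank ℂ K = m := by
    have h1 := (cformLin ρ w).finrank_range_add_finrank_ker
    have h2 : (cformLin ρ w).range = ⊤ :=
      LinearMap.range_eq_top.2 fun c => h.exists_cform_eq h0 hw c
    rw [h2, finrank_top, hW,
      Module.finrank_self] at h1
    change 1 + Module.finrank ℂ K = m + 1 at h1
    omega
  let b := Module.finBasisOfFinrankEq ℂ K hK
  have hw0 : (⟨w, h.cform_self h0⟩ : K) ≠ 0 := fun h' => h.ne_zero w h0 (congrArg Subtype.val h')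
  -- An automorphism of the kernel moves the first vector of a basis to `w`, so that the frame
  -- begins with `w`.
  obtain ⟨A, hA⟩ := SeparatingDual.exists_continuousLinearEquiv_apply_eq (R := ℂ)
    (b.ne_zero ⟨0, hm⟩) hw0
  let g : Fin m → W := fun i => (A (b i) : W)
  have hg : ∀ i, cform ρ w (g i) = 0 := fun i => (A (b i)).2
  have hgli : LinearIndependent ℂ g :=
    ((b.map A.toLinearEquiv).linearIndependent).map' K.subtype K.ker_subtype
  let f : Fin (m + 1) → W := Fin.snoc g e
  have hf0 : f 0 = w := by
    have h1 : (0 : Fin (m + 1)) = Fin.castSucc ⟨0, hm⟩ := rfl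
    rw [h1]
    simp only [f, Fin.snoc_castSucc, g, hA]
  have hfe : f (Fin.last m) = e := by simp [f]
  refine ⟨f, (h.mem_adaptedFrames_iff hm (by rwa [hf0])).2 ⟨by rwa [hf0], ⟨?_, fun α => ?_, ?_⟩⟩,
    hf0⟩
  · rw [mem_frames_iff hW, linearIndependent_finSnoc]
    refine ⟨hgli, fun hspan => ?_⟩
    have h1 : Submodule.span ℂ (Set.range g) ≤ K :=
      Submodule.span_le.2 (by rintro _ ⟨i, rfl⟩; exact hg i)
    have h2 : cform ρ w e = 0 := h1 hspan
    rw [he] at h2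
    exact Complex.I_ne_zero h2
  · obtain ⟨i, hi⟩ := Fin.exists_castSucc_eq.2 α.ne_last
    rw [hf0, ← hi]
    simpa [f] using hg i
  · rw [hf0, hfe, ← cform_re, he, Complex.I_re]

/-- Data which identify the tangent spaces of the cone over `S` along nearby lines. -/
structure IsChart (S : Set (ℙ ℂ W)) (C : Set W) (ρ : W → ℝ) (κ : W →L[ℂ] ℂ) (w₀ e : W) :
    Prop where
  isDefining : IsDefining S C ρ
  base_mem : w₀ ∈ C
  base_mem_cone : w₀ ∈ cone S
  apply_base : κ w₀ = 1
  apply_transverse : κ e = 0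
  cform_transverse : cform ρ w₀ e = 1

theorem exists_isChart (hS : IsCRHypersurface S) {w₀ : W} (hw₀ : w₀ ∈ cone S) :
    ∃ (C : Set W) (ρ : W → ℝ) (κ : W →L[ℂ] ℂ) (e : W), IsChart S C ρ κ w₀ e := by
  obtain ⟨C, ρ, h, h0⟩ := hS.exists_isDefining hw₀
  obtain ⟨e, he⟩ := h.exists_cform_eq h0 hw₀ 1
  obtain ⟨κ, hκ⟩ := SeparatingDual.exists_eq_one (R := ℂ) (h.ne_zero w₀ h0)
  refine ⟨C, ρ, κ, e + (-κ e) • w₀, h, h0, hw₀, hκ, ?_, ?_⟩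
  · simp [hκ]
  · rw [h.cform_add_smul_self h0, he]

/-- The lines on which a chart is defined. -/
def chartDomain (C : Set W) (ρ : W → ℝ) (κ : W →L[ℂ] ℂ) (e : W) : Set W :=
  {w | (w ∈ C ∧ κ w ≠ 0) ∧ cform ρ w e ≠ 0}

/-- A complex-linear map which takes the line of `w` to the line of `w₀` and the tangent space of
the cone at `w` to the one at the image of `w`. -/
def toBase (ρ : W → ℝ) (κ : W →L[ℂ] ℂ) (w₀ e w : W) : W →ₗ[ℂ] W :=
  LinearMap.id - (κ : W →ₗ[ℂ] ℂ).smulRight ((κ w)⁻¹ • w - w₀) +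
    (κ w • cformLin ρ w - cformLin ρ w₀ +
      ((κ w)⁻¹ * cform ρ w₀ w) • (κ : W →ₗ[ℂ] ℂ)).smulRight e

/-- The inverse of `toBase`. -/
def ofBase (ρ : W → ℝ) (κ : W →L[ℂ] ℂ) (w₀ e w : W) : W →ₗ[ℂ] W :=
  LinearMap.id + (κ : W →ₗ[ℂ] ℂ).smulRight ((κ w)⁻¹ • w - w₀) +
    ((κ w * cform ρ w e)⁻¹ • (cformLin ρ w₀ - κ w • cformLin ρ w +
      (κ w * cform ρ w w₀) • (κ : W →ₗ[ℂ] ℂ))).smulRight e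

theorem toBase_apply (ρ : W → ℝ) (κ : W →L[ℂ] ℂ) (w₀ e w y : W) :
    toBase ρ κ w₀ e w y = y - κ y • ((κ w)⁻¹ • w - w₀) +
      (κ w * cform ρ w y - cform ρ w₀ y + (κ w)⁻¹ * cform ρ w₀ w * κ y) • e := by
  simp [toBase]

theorem ofBase_apply (ρ : W → ℝ) (κ : W →L[ℂ] ℂ) (w₀ e w y : W) :
    ofBase ρ κ w₀ e w y = y + κ y • ((κ w)⁻¹ • w - w₀) +
      ((κ w * cform ρ w e)⁻¹ * (cform ρ w₀ y - κ w * cform ρ w y +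
        κ w * cform ρ w w₀ * κ y)) • e := by
  simp [ofBase, mul_add]

namespace IsChart

variable {κ : W →L[ℂ] ℂ} {w₀ e : W}

theorem base_mem_chartDomain (h : IsChart S C ρ κ w₀ e) : w₀ ∈ chartDomain C ρ κ e :=
  ⟨⟨h.base_mem, by simp [h.apply_base]⟩, by simp [h.cform_transverse]⟩

theorem isOpen_chartDomain (h : IsChart S C ρ κ w₀ e) : IsOpen (chartDomain C ρ κ e) := by
  have h1 : IsOpen {w | w ∈ C ∧ κ w ≠ 0} :=
    h.isDefining.isOpen.inter (isOpen_compl_singleton.preimage κ.continuous)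
  have h2 : ContinuousOn (fun w => cform ρ w e) {w | w ∈ C ∧ κ w ≠ 0} :=
    (h.isDefining.contDiffOn_cform.clm_apply contDiffOn_const).continuousOn.mono fun _ hw => hw.1
  exact h2.isOpen_inter_preimage h1 isOpen_compl_singleton

theorem smul_mem_chartDomain (h : IsChart S C ρ κ w₀ e) {c : ℂ} (hc : c ≠ 0) {w : W}
    (hw : w ∈ chartDomain C ρ κ e) : c • w ∈ chartDomain C ρ κ e := by
  refine ⟨⟨h.isDefining.smul_mem c hc w hw.1.1, ?_⟩, ?_⟩
  · simpa using ⟨hc, hw.1.2⟩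
  · rw [h.isDefining.cform_smul_left hw.1.1 hc]
    exact mul_ne_zero (inv_ne_zero hc) hw.2

theorem toBase_self (h : IsChart S C ρ κ w₀ e) {w : W} (hw : w ∈ chartDomain C ρ κ e) :
    toBase ρ κ w₀ e w w = κ w • w₀ := by
  have h1 : (κ w)⁻¹ * cform ρ w₀ w * κ w = cform ρ w₀ w := by
    rw [mul_right_comm, inv_mul_cancel₀ hw.1.2, one_mul]
  rw [toBase_apply, h.isDefining.cform_self hw.1.1, h1, smul_sub, smul_smul,
    mul_inv_cancel₀ hw.1.2]
  simp

/-- The coefficient of `e` in `toBase` is chosen for this identity. Since `w` goes to `κ w • w₀` and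
`cform` has degree `-1` in the base point, the factor `κ w` cancels: the value of `cform` is
preserved exactly, hence so are all adaptedness equations. -/
theorem cform_toBase (h : IsChart S C ρ κ w₀ e) {w : W} (y : W) :
    cform ρ w₀ (toBase ρ κ w₀ e w y) = κ w * cform ρ w y := by
  rw [toBase_apply]
  simp only [map_add, map_sub, cform_smul, h.cform_transverse,
    h.isDefining.cform_self h.base_mem]
  ring

theorem apply_toBase (h : IsChart S C ρ κ w₀ e) {w : W} (hw : w ∈ chartDomain C ρ κ e) (y : W) :
    κ (toBase ρ κ w₀ e w y) = κ y := by
  rw [toBase_apply]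
  simp [h.apply_base, h.apply_transverse, inv_mul_cancel₀ hw.1.2]

theorem cform_ofBase (h : IsChart S C ρ κ w₀ e) {w : W} (hw : w ∈ chartDomain C ρ κ e) (y : W) :
    κ w * cform ρ w (ofBase ρ κ w₀ e w y) = cform ρ w₀ y := by
  have h1 := hw.1.2
  have h2 := hw.2
  rw [ofBase_apply]
  simp only [map_add, map_sub, cform_smul, h.isDefining.cform_self hw.1.1]
  field_simp
  ring

theorem apply_ofBase (h : IsChart S C ρ κ w₀ e) {w : W} (hw : w ∈ chartDomain C ρ κ e) (y : W) :
    κ (ofBase ρ κ w₀ e w y) = κ y := by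
  rw [ofBase_apply]
  simp [h.apply_base, h.apply_transverse, inv_mul_cancel₀ hw.1.2]

theorem toBase_ofBase (h : IsChart S C ρ κ w₀ e) {w : W} (hw : w ∈ chartDomain C ρ κ e) (y : W) :
    toBase ρ κ w₀ e w (ofBase ρ κ w₀ e w y) = y := by
  -- Modulo `e` the two maps are inverse shears, as both preserve `κ`. The remaining multiple of `e`
  -- is detected by `cform ρ w₀`, which is `1` on `e`.
  obtain ⟨c, hc⟩ : ∃ c : ℂ, toBase ρ κ w₀ e w (ofBase ρ κ w₀ e w y) = y + c • e := by
    obtain ⟨d, hd⟩ : ∃ d : ℂ, ofBase ρ κ w₀ e w y = y + κ y • ((κ w)⁻¹ • w - w₀) + d • e :=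
      ⟨_, ofBase_apply ..⟩
    obtain ⟨d', hd'⟩ : ∃ d' : ℂ, toBase ρ κ w₀ e w (ofBase ρ κ w₀ e w y) =
      ofBase ρ κ w₀ e w y - κ (ofBase ρ κ w₀ e w y) • ((κ w)⁻¹ • w - w₀) + d' • e :=
      ⟨_, toBase_apply ..⟩
    exact ⟨d + d', by rw [hd', h.apply_ofBase hw, hd, add_smul]; abel⟩
  have h1 : cform ρ w₀ (toBase ρ κ w₀ e w (ofBase ρ κ w₀ e w y)) = cform ρ w₀ y := by
    rw [h.cform_toBase, h.cform_ofBase hw]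
  rw [hc, map_add, cform_smul, h.cform_transverse] at h1
  have h2 : c = 0 := by simpa using h1
  rw [hc, h2, zero_smul, add_zero]

theorem ofBase_toBase (h : IsChart S C ρ κ w₀ e) {w : W} (hw : w ∈ chartDomain C ρ κ e) (y : W) :
    ofBase ρ κ w₀ e w (toBase ρ κ w₀ e w y) = y := by
  obtain ⟨c, hc⟩ : ∃ c : ℂ, ofBase ρ κ w₀ e w (toBase ρ κ w₀ e w y) = y + c • e := by
    obtain ⟨d, hd⟩ : ∃ d : ℂ, toBase ρ κ w₀ e w y = y - κ y • ((κ w)⁻¹ • w - w₀) + d • e :=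
      ⟨_, toBase_apply ..⟩
    obtain ⟨d', hd'⟩ : ∃ d' : ℂ, ofBase ρ κ w₀ e w (toBase ρ κ w₀ e w y) =
      toBase ρ κ w₀ e w y + κ (toBase ρ κ w₀ e w y) • ((κ w)⁻¹ • w - w₀) + d' • e :=
      ⟨_, ofBase_apply ..⟩
    exact ⟨d + d', by rw [hd', h.apply_toBase hw, hd, add_smul]; abel⟩
  have h1 : κ w * cform ρ w (ofBase ρ κ w₀ e w (toBase ρ κ w₀ e w y)) = κ w * cform ρ w y := by
    rw [h.cform_ofBase hw, h.cform_toBase]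
  rw [hc, map_add, cform_smul] at h1
  have h2 : c = 0 := by simpa [hw.1.2, hw.2] using h1
  rw [hc, h2, zero_smul, add_zero]

/-- The map depends only on the line of `w`, as a trivialization over a subset of projective space
requires. -/
theorem toBase_smul (h : IsChart S C ρ κ w₀ e) {w : W} (hw : w ∈ chartDomain C ρ κ e) {c : ℂ}
    (hc : c ≠ 0) : toBase ρ κ w₀ e (c • w) = toBase ρ κ w₀ e w := by
  have h1 := hw.1.2
  ext y
  have e1 : (c * κ w)⁻¹ * c = (κ w)⁻¹ := by field_simp
  have e2 : c * κ w * (c⁻¹ * cform ρ w y) = κ w * cform ρ w y := by field_simp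
  rw [toBase_apply, toBase_apply, map_smul, smul_eq_mul, h.isDefining.cform_smul_left hw.1.1 hc,
    cform_smul, smul_smul, e2, ← mul_assoc, e1]

theorem ofBase_smul (h : IsChart S C ρ κ w₀ e) {w : W} (hw : w ∈ chartDomain C ρ κ e) {c : ℂ}
    (hc : c ≠ 0) : ofBase ρ κ w₀ e (c • w) = ofBase ρ κ w₀ e w := by
  ext y
  rw [← h.toBase_ofBase hw y, h.ofBase_toBase hw, ← h.toBase_smul hw hc,
    h.ofBase_toBase (h.smul_mem_chartDomain hc hw)]

theorem ofBase_base (h : IsChart S C ρ κ w₀ e) {w : W} (hw : w ∈ chartDomain C ρ κ e) :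
    ofBase ρ κ w₀ e w w₀ = (κ w)⁻¹ • w := by
  have h1 := h.ofBase_toBase hw w
  rw [h.toBase_self hw, map_smul] at h1
  rw [← inv_smul_smul₀ hw.1.2 (ofBase ρ κ w₀ e w w₀), h1]

theorem toBase_mem_adaptedFrames [FiniteDimensional ℂ W] (h : IsChart S C ρ κ w₀ e) (hm : 1 ≤ m)
    (hW : Module.finrank ℂ W = m + 1) {f : Fin (m + 1) → W} (hf : f ∈ adaptedFrames S m)
    (h0 : f 0 ∈ chartDomain C ρ κ e) :
    (fun a => toBase ρ κ w₀ e (f 0) (f a)) ∈ adaptedFrames S m := by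
  have h' := h.isDefining
  obtain ⟨hS, hf'⟩ := (h'.mem_adaptedFrames_iff hm h0.1.1).1 hf
  have hC : toBase ρ κ w₀ e (f 0) (f 0) ∈ C := by
    rw [h.toBase_self h0]
    exact h'.smul_mem _ h0.1.2 _ h.base_mem
  have hcf : ∀ a, cform ρ (toBase ρ κ w₀ e (f 0) (f 0)) (toBase ρ κ w₀ e (f 0) (f a)) =
      cform ρ (f 0) (f a) := by
    intro a
    rw [h.toBase_self h0, h'.cform_smul_left h.base_mem h0.1.2, h.cform_toBase,
      inv_mul_cancel_left₀ h0.1.2]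
  refine (h'.mem_adaptedFrames_iff hm hC).2 ⟨?_, ⟨?_, fun α => ?_, ?_⟩⟩
  · rw [h.toBase_self h0]
    exact smul_mem_cone h.base_mem_cone h0.1.2
  · refine (mem_frames_iff hW).2 (((mem_frames_iff hW).1 hf'.frame).map' _ ?_)
    exact LinearMap.ker_eq_bot.2 (Function.LeftInverse.injective (h.ofBase_toBase h0))
  · rw [hcf, hf'.mid]
  · rw [← cform_re, hcf, hf'.re_last]

theorem ofBase_mem_adaptedFrames [FiniteDimensional ℂ W] (h : IsChart S C ρ κ w₀ e) (hm : 1 ≤ m)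
    (hW : Module.finrank ℂ W = m + 1) {q : Fin (m + 1) → W} (hq : q ∈ adaptedFrames S m) {c : ℂ}
    (hc : c ≠ 0) (hq0 : q 0 = c • w₀) {w : W} (hw : w ∈ chartDomain C ρ κ e)
    (hwS : w ∈ cone S) : (fun a => ofBase ρ κ w₀ e w (q a)) ∈ adaptedFrames S m := by
  have h' := h.isDefining
  have h0 : q 0 ∈ C := hq0 ▸ h'.smul_mem _ hc _ h.base_mem
  obtain ⟨hS, hq'⟩ := (h'.mem_adaptedFrames_iff hm h0).1 hq
  have hw0 : ofBase ρ κ w₀ e w (q 0) = (c * (κ w)⁻¹) • w := by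
    rw [hq0, map_smul, h.ofBase_base hw, smul_smul]
  have hcw : c * (κ w)⁻¹ ≠ 0 := mul_ne_zero hc (inv_ne_zero hw.1.2)
  have hC : ofBase ρ κ w₀ e w (q 0) ∈ C := hw0 ▸ h'.smul_mem _ hcw _ hw.1.1
  have hcf : ∀ a, cform ρ (ofBase ρ κ w₀ e w (q 0)) (ofBase ρ κ w₀ e w (q a)) =
      cform ρ (q 0) (q a) := by
    intro a
    rw [hw0, hq0, h'.cform_smul_left hw.1.1 hcw, h'.cform_smul_left h.base_mem hc,
      ← h.cform_ofBase hw, mul_inv, inv_inv, mul_assoc]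
  refine (h'.mem_adaptedFrames_iff hm hC).2 ⟨?_, ⟨?_, fun α => ?_, ?_⟩⟩
  · rw [hw0]
    exact smul_mem_cone hwS hcw
  · refine (mem_frames_iff hW).2 (((mem_frames_iff hW).1 hq'.frame).map' _ ?_)
    exact LinearMap.ker_eq_bot.2 (Function.LeftInverse.injective (h.toBase_ofBase hw))
  · rw [hcf, hq'.mid]
  · rw [← cform_re, hcf, hq'.re_last]

section Smooth

variable {V : Type*} [NormedAddCommGroup V] [NormedSpace ℝ V] {s : Set V} {x y : V → W}

theorem contDiffOn_toBase (h : IsChart S C ρ κ w₀ e) (hx : ContDiffOn ℝ ∞ x s)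
    (hy : ContDiffOn ℝ ∞ y s) (hs : ∀ p ∈ s, x p ∈ chartDomain C ρ κ e) :
    ContDiffOn ℝ ∞ (fun p => toBase ρ κ w₀ e (x p) (y p)) s := by
  have hκ : ContDiff ℝ ∞ κ := (κ.restrictScalars ℝ).contDiff
  have hκx : ContDiffOn ℝ ∞ (fun p => κ (x p)) s := hκ.comp_contDiffOn hx
  have hκy : ContDiffOn ℝ ∞ (fun p => κ (y p)) s := hκ.comp_contDiffOn hy
  have hκi : ContDiffOn ℝ ∞ (fun p => (κ (x p))⁻¹) s := hκx.inv fun p hp => (hs p hp).1.2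
  have hcx : ContDiffOn ℝ ∞ (fun p => cform ρ (x p)) s :=
    h.isDefining.contDiffOn_cform.comp hx fun p hp => (hs p hp).1.1
  have hc0 : ∀ {z : V → W}, ContDiffOn ℝ ∞ z s → ContDiffOn ℝ ∞ (fun p => cform ρ w₀ (z p)) s :=
    fun hz => (cform ρ w₀).contDiff.comp_contDiffOn hz
  simp only [toBase_apply]
  exact (hy.sub (hκy.smul ((hκi.smul hx).sub contDiffOn_const))).add
    ((((hκx.mul (hcx.clm_apply hy)).sub (hc0 hy)).add ((hκi.mul (hc0 hx)).mul hκy)).smul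
      contDiffOn_const)

theorem contDiffOn_ofBase (h : IsChart S C ρ κ w₀ e) (hx : ContDiffOn ℝ ∞ x s)
    (hy : ContDiffOn ℝ ∞ y s) (hs : ∀ p ∈ s, x p ∈ chartDomain C ρ κ e) :
    ContDiffOn ℝ ∞ (fun p => ofBase ρ κ w₀ e (x p) (y p)) s := by
  have hκ : ContDiff ℝ ∞ κ := (κ.restrictScalars ℝ).contDiff
  have hκx : ContDiffOn ℝ ∞ (fun p => κ (x p)) s := hκ.comp_contDiffOn hx
  have hκy : ContDiffOn ℝ ∞ (fun p => κ (y p)) s := hκ.comp_contDiffOn hy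
  have hκi : ContDiffOn ℝ ∞ (fun p => (κ (x p))⁻¹) s := hκx.inv fun p hp => (hs p hp).1.2
  have hcx : ContDiffOn ℝ ∞ (fun p => cform ρ (x p)) s :=
    h.isDefining.contDiffOn_cform.comp hx fun p hp => (hs p hp).1.1
  have hc0 : ContDiffOn ℝ ∞ (fun p => cform ρ w₀ (y p)) s :=
    (cform ρ w₀).contDiff.comp_contDiffOn hy
  have hi : ContDiffOn ℝ ∞ (fun p => (κ (x p) * cform ρ (x p) e)⁻¹) s :=
    (hκx.mul (hcx.clm_apply contDiffOn_const)).inv fun p hp =>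
      mul_ne_zero (hs p hp).1.2 (hs p hp).2
  simp only [ofBase_apply]
  exact (hy.add (hκy.smul ((hκi.smul hx).sub contDiffOn_const))).add
    ((hi.mul ((hc0.sub (hκx.mul (hcx.clm_apply hy))).add
      ((hκx.mul (hcx.clm_apply contDiffOn_const)).mul hκy))).smul contDiffOn_const)

end Smooth

end IsChart

end Trivialization

/-! ### Correction by shifts, local trivializations and the sub-bundle. -/

section Subbundle

variable {W : Type*} [NormedAddCommGroup W] [NormedSpace ℂ W] {m : ℕ}
  {S : Set (ℙ ℂ W)}

/-- The shift of `g` which has the same coefficients `mix` and `nor` as `f`. -/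
def adjust (S : Set (ℙ ℂ W)) (f g : Fin (m + 1) → W) : Fin (m + 1) → W :=
  shift g (shiftVector (fun α => (secondOrder S f).mix α - (secondOrder S g).mix α)
    ((secondOrder S f).nor - (secondOrder S g).nor))

@[simp]
theorem adjust_zero (f g : Fin (m + 1) → W) : adjust S f g 0 = g 0 :=
  shift_zero (shiftVector_zero _ _) g

theorem shift_shift {d d' : Fin (m + 1) → ℂ} (hd : d 0 = 0) (f : Fin (m + 1) → W) :
    shift (shift f d) d' = shift f (d + d') := by
  funext a
  simp [shift, hd, add_smul, add_assoc]

theorem map_shift (A : W →ₗ[ℂ] W) (f : Fin (m + 1) → W) (d : Fin (m + 1) → ℂ) :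
    (fun a => A (shift f d a)) = shift (fun a => A (f a)) d := by
  funext a
  simp [shift]

theorem re_eq_zero_of_conj {z : ℂ} (h : conj z = -z) : z.re = 0 := by
  have := congrArg Complex.re h
  simp only [Complex.conj_re, Complex.neg_re] at this
  linarith

variable [FiniteDimensional ℂ W]

theorem adjust_spec (hS : IsCRHypersurface S) (hm : 1 ≤ m) (hW : Module.finrank ℂ W = m + 1)
    {f g : Fin (m + 1) → W} (hf : f ∈ adaptedFrames S m) (hg : g ∈ adaptedFrames S m) :
    adjust S f g ∈ adaptedFrames S m ∧
    (∀ α, (secondOrder S (adjust S f g)).mix α = (secondOrder S f).mix α) ∧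
    (secondOrder S (adjust S f g)).nor = (secondOrder S f).nor := by
  have h1 := secondOrder_shift hS hm hW hg (shiftVector_zero
    (fun α => (secondOrder S f).mix α - (secondOrder S g).mix α)
    ((secondOrder S f).nor - (secondOrder S g).nor))
  refine ⟨shift_mem_adaptedFrames hS hm hW hg (shiftVector_zero _ _), fun α => ?_, ?_⟩
  · rw [adjust, h1.1, shiftVector_mid]
    ring
  · rw [adjust, h1.2, shiftVector_last hm]
    have hf' := re_eq_zero_of_conj (secondOrder_symm hS hm hW hf).2.2
    have hg' := re_eq_zero_of_conj (secondOrder_symm hS hm hW hg).2.2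
    have h4 : ∀ z : ℂ, (-z / 4).im = -z.im / 4 := fun z => by
      rw [show (4 : ℂ) = ((4 : ℝ) : ℂ) by norm_num, Complex.div_ofReal_im, Complex.neg_im]
    rw [h4]
    apply Complex.ext
    · simp [hf', hg']
    · simp
      ring

/-- `mix` and `nor` determine a shift up to the real part of its last entry. All shifts made by
`adjust` have that real part zero, so going to the base fibre and back is the identity. -/
theorem shift_eq_self (hS : IsCRHypersurface S) (hm : 1 ≤ m) (hW : Module.finrank ℂ W = m + 1)
    {f : Fin (m + 1) → W} (hf : f ∈ adaptedFrames S m) {d : Fin (m + 1) → ℂ} (hd : d 0 = 0)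
    (hre : (d (Fin.last m)).re = 0)
    (hmix : ∀ α, (secondOrder S (shift f d)).mix α = (secondOrder S f).mix α)
    (hnor : (secondOrder S (shift f d)).nor = (secondOrder S f).nor) : shift f d = f := by
  obtain ⟨h1, h2⟩ := secondOrder_shift hS hm hW hf hd
  have h3 : ∀ a, d a = 0 := by
    intro a
    rcases eq_zero_or_mid_or_last a with rfl | ⟨α, rfl⟩ | rfl
    · exact hd
    · have := h1 α
      rw [hmix α] at this
      exact left_eq_add.1 this
    · rw [hnor] at h2
      have h5 : (4 * Complex.I * (d (Fin.last m)).im : ℂ) = 0 := by linear_combination h2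
      have h6 : (d (Fin.last m)).im = 0 := by simpa using h5
      exact Complex.ext hre h6
  funext a
  simp [shift, h3]

theorem exists_adjust_eq_shift (hS : IsCRHypersurface S) (hm : 1 ≤ m)
    (hW : Module.finrank ℂ W = m + 1) {f g : Fin (m + 1) → W} (hf : f ∈ adaptedFrames S m)
    (hg : g ∈ adaptedFrames S m) :
    ∃ d : Fin (m + 1) → ℂ, d 0 = 0 ∧ (d (Fin.last m)).re = 0 ∧ adjust S f g = shift g d := by
  refine ⟨_, shiftVector_zero _ _, ?_, rfl⟩
  have hf' := re_eq_zero_of_conj (secondOrder_symm hS hm hW hf).2.2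
  have hg' := re_eq_zero_of_conj (secondOrder_symm hS hm hW hg).2.2
  rw [shiftVector_last hm, show (4 : ℂ) = ((4 : ℝ) : ℂ) by norm_num, Complex.div_ofReal_re]
  simp [hf', hg']

/-- If `A` maps an adjustment of `g` to adapted frames, and `g` to `f`, then adjusting back yields
`f`. -/
theorem adjust_map_adjust (hS : IsCRHypersurface S) (hm : 1 ≤ m)
    (hW : Module.finrank ℂ W = m + 1) {f g : Fin (m + 1) → W} (hf : f ∈ adaptedFrames S m)
    (hg : g ∈ adaptedFrames S m) (A : W →ₗ[ℂ] W) (hA : ∀ a, A (g a) = f a)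
    (hAf : (fun a => A (adjust S f g a)) ∈ adaptedFrames S m) :
    adjust S (adjust S f g) (fun a => A (adjust S f g a)) = f := by
  have hfg := adjust_spec hS hm hW hf hg
  have h1 := adjust_spec hS hm hW hfg.1 hAf
  obtain ⟨d, hd, hre, hfgd⟩ := exists_adjust_eq_shift hS hm hW hf hg
  obtain ⟨d', hd', hre', h2⟩ := exists_adjust_eq_shift hS hm hW hfg.1 hAf
  have h3 : adjust S (adjust S f g) (fun a => A (adjust S f g a)) = shift f (d + d') := by
    have h4 : (fun a => A (adjust S f g a)) = shift f d := by
      rw [hfgd, map_shift, funext hA]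
    rw [h2, h4, shift_shift hd]
  rw [h3] at h1 ⊢
  exact shift_eq_self hS hm hW hf (by simp [hd, hd']) (by simp [hre, hre']) (fun α => (h1.2.1 α).trans (hfg.2.1 α))
    (h1.2.2.trans hfg.2.2)

theorem adjust_mem_normalFrames_iff (hS : IsCRHypersurface S) (hm : 1 ≤ m)
    (hW : Module.finrank ℂ W = m + 1) {f g : Fin (m + 1) → W} (hf : f ∈ adaptedFrames S m)
    (hg : g ∈ adaptedFrames S m) : f ∈ normalFrames m S ↔ adjust S f g ∈ normalFrames m S := by
  have h := adjust_spec hS hm hW hf hg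
  simp only [normalFrames, Set.mem_ofPred_eq, hf, h.1, h.2.1, h.2.2]

theorem exists_mem_normalFrames (hS : IsCRHypersurface S) (hm : 1 ≤ m)
    (hW : Module.finrank ℂ W = m + 1) {w : W} (hw : w ∈ cone S) :
    ∃ f ∈ normalFrames m S, f 0 = w := by
  obtain ⟨f, hf, rfl⟩ := exists_mem_adaptedFrames hS hm hW hw
  let d := shiftVector (fun α => -(secondOrder S f).mix α) (-(secondOrder S f).nor)
  have hd : d 0 = 0 := shiftVector_zero _ _
  obtain ⟨h1, h2⟩ := secondOrder_shift hS hm hW hf hd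
  refine ⟨shift f d, ⟨shift_mem_adaptedFrames hS hm hW hf hd, fun α => ?_, ?_⟩, shift_zero hd f⟩
  · rw [h1]
    simp [d]
  · have hf' := re_eq_zero_of_conj (secondOrder_symm hS hm hW hf).2.2
    rw [h2]
    simp only [d, shiftVector_last hm, neg_neg]
    rw [show (4 : ℂ) = ((4 : ℝ) : ℂ) by norm_num, Complex.div_ofReal_im]
    apply Complex.ext
    · simp [hf']
    · simp
      ring

theorem contDiffOn_secondOrder_mix (hS : IsCRHypersurface S) (hm : 1 ≤ m)
    (hW : Module.finrank ℂ W = m + 1) (α : Mid m) :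
    ContDiffOn ℝ ∞ (fun f => (secondOrder S f).mix α) (adaptedFrames S m) :=
  contDiffOn_secondOrder hS hm hW (fun Q => Q.mix α) fun _ _ h => h.contDiffOn_mix α

theorem contDiffOn_secondOrder_nor (hS : IsCRHypersurface S) (hm : 1 ≤ m)
    (hW : Module.finrank ℂ W = m + 1) :
    ContDiffOn ℝ ∞ (fun f : Fin (m + 1) → W => (secondOrder S f).nor) (adaptedFrames S m) :=
  contDiffOn_secondOrder hS hm hW (fun Q => Q.nor) fun _ _ h => h.contDiffOn_nor

theorem contDiffOn_adjust (hS : IsCRHypersurface S) (hm : 1 ≤ m)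
    (hW : Module.finrank ℂ W = m + 1) {V : Type*} [NormedAddCommGroup V] [NormedSpace ℝ V]
    {s : Set V} {f g : V → Fin (m + 1) → W} (hf : ContDiffOn ℝ ∞ f s) (hg : ContDiffOn ℝ ∞ g s)
    (hfs : ∀ p ∈ s, f p ∈ adaptedFrames S m) (hgs : ∀ p ∈ s, g p ∈ adaptedFrames S m) :
    ContDiffOn ℝ ∞ (fun p => adjust S (f p) (g p)) s := by
  have hmix := contDiffOn_secondOrder_mix hS hm hW
  have hnor := contDiffOn_secondOrder_nor hS hm hW
  have hga := fun a => (contDiffOn_pi.1 hg) a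
  refine contDiffOn_pi.2 fun a => ?_
  refine (hga a).add (ContDiffOn.smul ?_ (hga 0))
  rcases eq_zero_or_mid_or_last a with rfl | ⟨α, rfl⟩ | rfl
  · simp only [shiftVector_zero]
    exact contDiffOn_const
  · simp only [shiftVector_mid]
    exact ((hmix α).comp hf hfs).sub ((hmix α).comp hg hgs)
  · simp only [shiftVector_last hm]
    exact (((hnor.comp hf hfs).sub (hnor.comp hg hgs)).neg).div_const _

/-- The linear maps `toBase` and `ofBase` identify the fibres of adapted frames but need not
preserve `mix` and `nor`. Adjusting the image to the coefficients of the original frame repairs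
this, and the normalized frames then correspond. -/
theorem exists_isTrivialization (hS : IsCRHypersurface S) (hm : 1 ≤ m)
    (hW : Module.finrank ℂ W = m + 1) {z : ℙ ℂ W} (hz : z ∈ S) :
    ∃ (U : Set (ℙ ℂ W)) (Φ : (Fin (m + 1) → W) → (Fin (m + 1) → W))
      (Ψ : W → (Fin (m + 1) → W) → (Fin (m + 1) → W)), IsOpenProj U ∧ z ∈ U ∧
        IsTrivialization S (adaptedFrames S m) (normalFrames m S) z U Φ Ψ := by
  obtain ⟨C, ρ, κ, e, h⟩ := exists_isChart hS (rep_mem_cone.2 hz)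
  obtain ⟨U, hU⟩ := exists_cone_eq (C := chartDomain C ρ κ e)
    (fun w hw => h.isDefining.ne_zero w hw.1.1) fun c hc w hw => h.smul_mem_chartDomain hc hw
  have hT : ∀ f ∈ restrictTo (adaptedFrames S m) U,
      (fun a => toBase ρ κ z.rep e (f 0) (f a)) ∈ adaptedFrames S m := fun f hf =>
    h.toBase_mem_adaptedFrames hm hW hf.1 (hU ▸ hf.2)
  have hR : ∀ w ∈ cone (S ∩ U), ∀ q ∈ restrictTo (adaptedFrames S m) {z},
      (fun a => ofBase ρ κ z.rep e w (q a)) ∈ adaptedFrames S m := by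
    intro w hw q hq
    obtain ⟨c, hc, hq0⟩ := mem_cone_singleton_iff.1 hq.2
    obtain ⟨hw1, hw2⟩ := mem_cone_inter.1 hw
    exact h.ofBase_mem_adaptedFrames hm hW hq.1 hc hq0 (hU ▸ hw2) hw1
  have hR0 : ∀ w ∈ cone (S ∩ U), ∀ q ∈ restrictTo (adaptedFrames S m) {z},
      ∃ c : ℂ, c ≠ 0 ∧ ofBase ρ κ z.rep e w (q 0) = c • w := by
    intro w hw q hq
    obtain ⟨c, hc, hq0⟩ := mem_cone_singleton_iff.1 hq.2
    have hw2 : w ∈ chartDomain C ρ κ e := hU ▸ (mem_cone_inter.1 hw).2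
    exact ⟨c * (κ w)⁻¹, mul_ne_zero hc (inv_ne_zero hw2.1.2), by
      rw [hq0, map_smul, h.ofBase_base hw2, smul_smul]⟩
  have hline : ∀ x ∈ S ∩ U, ∀ w ∈ cone {x}, w ∈ cone (S ∩ U) := by
    rintro x hx w ⟨hw, hwx⟩
    exact ⟨hw, by rwa [Set.mem_singleton_iff.1 hwx]⟩
  refine ⟨U, fun f => adjust S f fun a => toBase ρ κ z.rep e (f 0) (f a),
    fun w q => adjust S q fun a => ofBase ρ κ z.rep e w (q a), ?_, ?_, ?_⟩
  · rw [IsOpenProj, hU]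
    exact h.isOpen_chartDomain
  · rw [← rep_mem_cone, hU]
    exact h.base_mem_chartDomain
  constructor
  · intro f hf
    have hf0 : f 0 ∈ chartDomain C ρ κ e := hU ▸ hf.2
    refine ⟨(adjust_spec hS hm hW hf.1 (hT f hf)).1, ?_⟩
    rw [adjust_zero, h.toBase_self hf0]
    exact mem_cone_singleton_iff.2 ⟨_, hf0.1.2, rfl⟩
  · intro x hx w hw q hq
    have hw' := hline x hx w hw
    refine ⟨(adjust_spec hS hm hW hq.1 (hR w hw' q hq)).1, ?_⟩
    obtain ⟨c, hc, hcw⟩ := hR0 w hw' q hq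
    rw [adjust_zero, hcw]
    exact smul_mem_cone hw hc
  · intro w hw q hq
    have hw2 : w ∈ chartDomain C ρ κ e := hU ▸ (mem_cone_inter.1 hw).2
    obtain ⟨c, hc, hcw⟩ := hR0 w hw q hq
    have hadj := (adjust_spec hS hm hW hq.1 (hR w hw q hq)).1
    -- Adjusting leaves the first vector on the line of `w`, so the way back uses the inverse of the
    -- same linear map.
    have hbase : toBase ρ κ z.rep e (adjust S q (fun a => ofBase ρ κ z.rep e w (q a)) 0) =
        toBase ρ κ z.rep e w := by
      rw [adjust_zero, hcw, h.toBase_smul hw2 hc]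
    have hmem := hT _ ⟨hadj, by
      rw [adjust_zero, hcw]
      exact smul_mem_cone (mem_cone_inter.1 hw).2 hc⟩
    rw [hbase] at hmem
    simp only [hbase]
    exact adjust_map_adjust hS hm hW hq.1 (hR w hw q hq) _ (fun a => h.toBase_ofBase hw2 (q a))
      hmem
  · intro x hx w hw f hf
    have hw' := hline x hx w hw
    have hf' : f ∈ restrictTo (adaptedFrames S m) U :=
      ⟨hf.1, (mem_cone_inter.1 (hline x hx _ hf.2)).2⟩
    have hf0 : f 0 ∈ chartDomain C ρ κ e := hU ▸ hf'.2
    have hbase : ofBase ρ κ z.rep e w = ofBase ρ κ z.rep e (f 0) := by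
      obtain ⟨a, ha, hwa⟩ := mem_cone_singleton_iff.1 hw
      obtain ⟨b, hb, hfb⟩ := mem_cone_singleton_iff.1 hf.2
      have hwf : w = (a * b⁻¹) • f 0 := by
        rw [hfb, smul_smul, inv_mul_cancel_right₀ hb, hwa]
      rw [hwf, h.ofBase_smul hf0 (mul_ne_zero ha (inv_ne_zero hb))]
    have hadj := adjust_spec hS hm hW hf.1 (hT f hf')
    have hmem := hR w hw' (adjust S f fun a => toBase ρ κ z.rep e (f 0) (f a)) ⟨hadj.1, by
      rw [adjust_zero, h.toBase_self hf0]
      exact mem_cone_singleton_iff.2 ⟨_, hf0.1.2, rfl⟩⟩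
    exact adjust_map_adjust hS hm hW hf.1 (hT f hf') _
      (fun a => by rw [hbase, h.ofBase_toBase hf0]) hmem
  · refine contDiffOn_adjust hS hm hW contDiffOn_id (contDiffOn_pi.2 fun a => ?_)
      (fun f hf => hf.1) hT
    exact h.contDiffOn_toBase (contDiff_apply ℝ W 0).contDiffOn (contDiff_apply ℝ W a).contDiffOn
      fun f hf => hU ▸ hf.2
  · refine contDiffOn_adjust hS hm hW contDiff_snd.contDiffOn (contDiffOn_pi.2 fun a => ?_)
      (fun p hp => hp.2.1) fun p hp => hR p.1 hp.1 p.2 hp.2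
    exact h.contDiffOn_ofBase contDiff_fst.contDiffOn
      ((contDiff_apply ℝ W a).comp contDiff_snd).contDiffOn
      fun p hp => hU ▸ (mem_cone_inter.1 hp.1).2
  · exact fun f hf => adjust_mem_normalFrames_iff hS hm hW hf.1 (hT f hf)

theorem isSubbundle_normalFrames (hS : IsCRHypersurface S) (hm : 1 ≤ m)
    (hW : Module.finrank ℂ W = m + 1) :
    IsSubbundle S (adaptedFrames S m) (normalFrames m S) where
  subset _ hf := hf.1
  base _ hf := hf.2.1
  submanifold_total := isEmbeddedSubmanifold_adaptedFrames hS hm hW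
  submanifold := isEmbeddedSubmanifold_normalFrames hS hm hW
  surj z hz := by
    obtain ⟨f, hf, hf0⟩ := exists_mem_normalFrames hS hm hW (rep_mem_cone.2 hz)
    exact ⟨f, hf, hf0 ▸ rep_mem_cone.2 rfl⟩
  locally_trivial _ hz := exists_isTrivialization hS hm hW hz

theorem conj_maurerCartan_of_mem_tangentVectors (hS : IsCRHypersurface S) (hm : 1 ≤ m)
    (hW : Module.finrank ℂ W = m + 1) {f v : Fin (m + 1) → W} (hf : f ∈ adaptedFrames S m)
    (hv : v ∈ tangentVectors (adaptedFrames S m) f) :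
    conj (maurerCartan f v (Fin.last m) 0) = maurerCartan f v (Fin.last m) 0 := by
  obtain ⟨C, ρ, h, h0⟩ := hS.exists_isDefining hf.2.1
  have hf' := (h.mem_adaptedFrames_iff hm h0).1 hf
  exact h.conj_maurerCartan_last hm h0 hf'.1 hf'.2
    ((h.mem_tangentVectors_adaptedFrames_iff hm hW hf h0).1 hv)

end Subbundle

end CRHyp

end

theorem lemmaL {W : Type*} [NormedAddCommGroup W] [NormedSpace ℂ W] [FiniteDimensional ℂ W]
    (m : ℕ) (hm : 1 ≤ m) (hW : Module.finrank ℂ W = m + 1)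
    (S : Set (ℙ ℂ W)) (hS : CRHyp.IsCRHypersurface S) :
    ∃ P : (Fin (m + 1) → W) → CRHyp.SecondOrder m,
      -- `P` is the smooth family of second-order coefficients on the adapted frames
      (∀ f ∈ CRHyp.adaptedFrames S m, ∀ Q : CRHyp.SecondOrder m,
        CRHyp.IsSecondOrder S f Q ↔ Q = P f) ∧
      (∀ f ∈ CRHyp.adaptedFrames S m,
        (∀ α β, (P f).hol β α = (P f).hol α β) ∧
        (∀ α β, conj ((P f).herm α β) = -(P f).herm β α) ∧
        conj ((P f).nor) = -(P f).nor) ∧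
      (∀ α β, ContDiffOn ℝ ∞ (fun f => (P f).hol α β) (CRHyp.adaptedFrames S m)) ∧
      (∀ α β, ContDiffOn ℝ ∞ (fun f => (P f).herm α β) (CRHyp.adaptedFrames S m)) ∧
      (∀ α, ContDiffOn ℝ ∞ (fun f => (P f).mix α) (CRHyp.adaptedFrames S m)) ∧
      ContDiffOn ℝ ∞ (fun f => (P f).nor) (CRHyp.adaptedFrames S m) ∧
      -- the locus where `P_{αm}` and `P_{mm}` vanish is a sub-bundle `PS`, and
      -- on it the Maurer-Cartan form satisfies the normalized equations
      ∃ PS : Set (Fin (m + 1) → W),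
        PS = {f | f ∈ CRHyp.adaptedFrames S m ∧ (∀ α, (P f).mix α = 0) ∧ (P f).nor = 0} ∧
        CRHyp.IsSubbundle S (CRHyp.adaptedFrames S m) PS ∧
        ∀ f ∈ PS, ∀ v ∈ CRHyp.tangentVectors PS f,
          conj (CRHyp.maurerCartan f v (Fin.last m) 0) =
            CRHyp.maurerCartan f v (Fin.last m) 0 ∧
          (∀ α : CRHyp.Mid m, CRHyp.maurerCartan f v (Fin.last m) α =
            ∑ β : CRHyp.Mid m, (P f).hol α β * CRHyp.maurerCartan f v β 0
              + ∑ β : CRHyp.Mid m, (P f).herm α β * conj (CRHyp.maurerCartan f v β 0)) ∧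
          CRHyp.maurerCartan f v 0 0
              + conj (CRHyp.maurerCartan f v (Fin.last m) (Fin.last m)) =
            conj (CRHyp.maurerCartan f v 0 0)
              + CRHyp.maurerCartan f v (Fin.last m) (Fin.last m) := by
  have hiff : ∀ f ∈ CRHyp.adaptedFrames S m, ∀ Q : CRHyp.SecondOrder m,
      CRHyp.IsSecondOrder S f Q ↔ Q = CRHyp.secondOrder S f := by
    intro f hf Q
    obtain ⟨C, ρ, h, h0⟩ := hS.exists_isDefining hf.2.1
    exact h.isSecondOrder_iff hm hW hf h0 Q
  refine ⟨CRHyp.secondOrder S, hiff, fun f hf => CRHyp.secondOrder_symm hS hm hW hf,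
    fun α β => CRHyp.contDiffOn_secondOrder hS hm hW (fun Q => Q.hol α β)
      fun _ _ h => h.contDiffOn_hol α β,
    fun α β => CRHyp.contDiffOn_secondOrder hS hm hW (fun Q => Q.herm α β)
      fun _ _ h => h.contDiffOn_herm α β,
    CRHyp.contDiffOn_secondOrder_mix hS hm hW, CRHyp.contDiffOn_secondOrder_nor hS hm hW,
    CRHyp.normalFrames m S, rfl, CRHyp.isSubbundle_normalFrames hS hm hW, ?_⟩
  rintro f ⟨hf, hmix, hnor⟩ v hv
  have hv' := CRHyp.tangentVectors_mono (fun _ h => h.1) f hv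
  have hP := (hiff f hf _).2 rfl
  refine ⟨CRHyp.conj_maurerCartan_of_mem_tangentVectors hS hm hW hf hv', fun α => ?_, ?_⟩
  · simpa [hmix] using hP.mid v hv' α
  · have := hP.last v hv'
    simp only [hmix, hnor, map_zero, zero_mul, Finset.sum_const_zero, neg_zero, add_zero] at this
    exact sub_eq_zero.1 this
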